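/- Let $\mathbf M\subset\mathbf R^s$ be a compact smooth $m$-dimensional submanifold without boundary. The cutlocus $\mathbf C$ of $\mathbf M$ is the set of $x\in\mathbf R^s$ for which the point of $\mathbf M$ nearest to $x$ is not unique, or for which the square distance function $q\mapsto\|q-x\|^2$ on $\mathbf M$ has a degenerate second derivative at the unique nearest point. Let $\pi:\mathbf R^s\setminus\mathbf C\to\mathbf M$ be the nearest-point mapping. For $\mu\in\mathbf M$ let $\tan_\mu$ and $\mathrm{nor}_\mu=I_s-\tan_\mu$ be the orthogonal projections of $\mathbf R^s$ onto the tangent space $T_\mu\mathbf M$ and onto its orthogonal complement. For a normal vector $\nu$ at $\mu$ let $A_\nu:T_\mu\mathbf M\to T_\mu\mathbf M$, $A_\nu(w)=-\tan_\mu(D_w v)$, be the Weingarten mapping, where $v$ is any smooth normal vector field along $\mathbf M$ with $v(\mu)=\nu$, for example $v(\alpha)=\mathrm{nor}_\alpha(\nu)$. For a symmetric positive definite matrix $B$, $B^{1/2}$ is its symmetric positive definite square root and $B^{-1/2}=(B^{1/2})^{-1}$. Let $t\in\mathbf R^s\setminus\mathbf C$, $\mu=\pi(t)$, and $G=I_s-A_{t-\mu}\tan_\mu$.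 Let $\tilde t_n$ be random vectors in $\mathbf R^s$, and let $\tilde\mu_n=\pi(\tilde t_n)$, where $\tilde\mu_n$ may be any random vector on the event $\tilde t_n\in\mathbf C$. Let $V$ be a symmetric positive definite $s\times s$ matrix and $a_n$ real numbers with $a_n\to\infty$ such that $$Z_n=a_nV^{-1/2}(\tilde t_n-t)\xrightarrow{\mathcal D}Z$$ for some random vector $Z$ in $\mathbf R^s$. Then: 1. $\|\tilde\mu_n-\mu\|\to0$ in probability. Suppose furthermore that $Z$ is spherical, that is, $HZ$ and $Z$ have the same distribution for every orthogonal matrix $H$. Then: 2. $a_n(\mathrm{nor}_\mu+\tan_\mu V\tan_\mu)^{-1/2}G(\tilde\mu_n-\mu)=(\mathrm{nor}_\mu+\tan_\mu V\tan_\mu)^{-1/2}\tan_\mu V^{1/2}Z_n+o_{\mathbf P}(1)\xrightarrow{\mathcal D}\tan_\mu Z$. 3. $a_n^2(\tilde\mu_n-\mu)^TG(\mathrm{nor}_\mu+\tan_\mu V\tan_\mu)^{-1}G(\tilde\mu_n-\mu)\xrightarrow{\mathcal D}\zeta_m^2$, where $\zeta_m^2=Z_1^2+\dots+Z_m^2$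 is the sum of the squares of the first $m$ coordinates of $Z$; in particular the limit distribution does not depend on $\mu$. -/

import Mathlib

open MeasureTheory ProbabilityTheory Filter Topology
open scoped MatrixOrder

noncomputable section

namespace MeanLocation

/-- Euclidean space `ℝˢ`. -/
abbrev E (s : ℕ) : Type := EuclideanSpace ℝ (Fin s)

/-- Real `s × s` matrices. -/
abbrev Mat (s : ℕ) : Type := Matrix (Fin s) (Fin s) ℝ

variable {s : ℕ}

/-- The matrix `A` acting on the vector `x` of `ℝˢ`. -/
def app (A : Mat s) (x : E s) : E s := Matrix.toEuclideanCLM (n := Fin s) (𝕜 := ℝ) A x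

/-- The matrix (in the standard basis) of a linear endomorphism of `ℝˢ`. -/
def mat (T : E s →L[ℝ] E s) : Mat s := (Matrix.toEuclideanCLM (n := Fin s) (𝕜 := ℝ)).symm T

/-- `B^{1/2}`: for positive definite `B`, the unique positive definite `S` with `S * S = B`. -/
def rootMat (B : Mat s) : Mat s := CFC.sqrt B

/-- `B^{-1/2}`. -/
def invRootMat (B : Mat s) : Mat s := (rootMat B)⁻¹

section Submanifolds

open scoped ContDiff

/-! ### Submanifolds of Euclidean space -/

/-- `Φ` is a smooth diffeomorphism between open subsets of `ℝˢ` which flattens `M`, that is, carries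
the part of `M` in its domain to the part of the linear subspace `L` in its image. In particular
`Φ` restricted to `M` is a local coordinate system on `M` with values in `L`, with inverse
`Φ.symm` restricted to `L`. -/
structure IsSliceChart (M : Set (E s)) (Φ : OpenPartialHomeomorph (E s) (E s))
    (L : Submodule ℝ (E s)) : Prop where
  contDiffOn : ContDiffOn ℝ ∞ Φ Φ.source
  contDiffOn_symm : ContDiffOn ℝ ∞ Φ.symm Φ.target
  mem_iff : ∀ q ∈ Φ.source, q ∈ M ↔ Φ q ∈ L

/-- `M` is an `m`-dimensional smooth (embedded) submanifold of `ℝˢ`, without boundary. -/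
def IsSubmanifold (m : ℕ) (M : Set (E s)) : Prop :=
  ∀ p ∈ M, ∃ (Φ : OpenPartialHomeomorph (E s) (E s)) (L : Submodule ℝ (E s)),
    p ∈ Φ.source ∧ Module.finrank ℝ L = m ∧ IsSliceChart M Φ L

/-- The tangent space of `M` at `p`: velocities at `p` of smooth curves in `M`. (For a submanifold
these velocities already form a linear subspace, so that the span adds nothing.) -/
def tangentSpaceAt (M : Set (E s)) (p : E s) : Submodule ℝ (E s) :=
  Submodule.span ℝ {v | ∃ γ : ℝ → E s, ContDiffAt ℝ ∞ γ 0 ∧ γ 0 = p ∧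
    (∀ᶠ u in 𝓝 (0 : ℝ), γ u ∈ M) ∧ deriv γ 0 = v}

/-- `tan_p`, the orthogonal projection onto the tangent space. -/
def tanProj (M : Set (E s)) (p : E s) : E s →L[ℝ] E s := (tangentSpaceAt M p).starProjection

/-- `nor_p = I - tan_p`, the orthogonal projection onto the normal space. -/
def norProj (M : Set (E s)) (p : E s) : E s →L[ℝ] E s :=
  ContinuousLinearMap.id ℝ (E s) - tanProj M p

/-- The operator `A_ν ∘ tan_p`, where `A_ν w = - tan_p (D_w v)` is the Weingarten mapping of the
normal vector `ν` at `p`, formed with the normal field `v α = nor_α ν` along `M`. The derivative is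
taken along `M` and only applied to tangent vectors, where it is uniquely determined. -/
def weingarten (M : Set (E s)) (p ν : E s) : E s →L[ℝ] E s :=
  -(tanProj M p ∘L fderivWithin ℝ (fun α => norProj M α ν) M p ∘L tanProj M p)

/-! ### Nearest points and the cutlocus -/

/-- `p` is a point of `M` at minimal distance from `x`. -/
def IsNearest (M : Set (E s)) (x p : E s) : Prop :=
  p ∈ M ∧ ∀ q ∈ M, ‖p - x‖ ≤ ‖q - x‖

/-- The nearest-point mapping `π` (with an arbitrary value where no nearest point exists, and
an arbitrary choice among the nearest points where there are several). -/
def nearestPoint (M : Set (E s)) (x : E s) : E s := Classical.epsilon (IsNearest M x)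

/-- The square distance function `q ↦ ‖q - x‖²` on `M` has a nondegenerate second derivative at
`p`: its Hessian in local coordinates of `M` around `p` is a nondegenerate bilinear form. At a
critical point, in particular at a nearest point, this does not depend on the coordinates. -/
def HasNondegenerateHessian (M : Set (E s)) (x p : E s) : Prop :=
  ∃ (Φ : OpenPartialHomeomorph (E s) (E s)) (L : Submodule ℝ (E s)),
    p ∈ Φ.source ∧ IsSliceChart M Φ L ∧
      ∀ v ∈ L, (∀ w ∈ L,
        fderiv ℝ (fderiv ℝ (fun y => ‖Φ.symm y - x‖ ^ 2)) (Φ p) v w = 0) → v = 0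

/-- The cutlocus of `M`. -/
def cutlocus (M : Set (E s)) : Set (E s) :=
  {x | ¬ (∃! p, IsNearest M x p) ∨ ¬ HasNondegenerateHessian M x (nearestPoint M x)}

end Submanifolds

/-! ### The matrices in the limit theorem -/

/-- The matrix of `tan_p`. -/
def tanMat (M : Set (E s)) (p : E s) : Mat s := mat (tanProj M p)

/-- The matrix of `nor_p`. -/
def norMat (M : Set (E s)) (p : E s) : Mat s := mat (norProj M p)

/-- `G = I - A_{t - μ} tan_μ`, with `μ = π t`. -/
def stabG (M : Set (E s)) (t : E s) : Mat s :=
  1 - mat (weingarten M (nearestPoint M t) (t - nearestPoint M t))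

/-- `nor_p + tan_p V tan_p`. -/
def stabV (M : Set (E s)) (V : Mat s) (p : E s) : Mat s :=
  norMat M p + tanMat M p * V * tanMat M p

/-! ### Probability -/

/-- `X_n → 0` in probability, where `X_n` may live on a probability space depending on `n`. -/
def TendstoZeroInProb {Ω : ℕ → Type*} [∀ n, MeasurableSpace (Ω n)] (P : ∀ n, Measure (Ω n))
    (X : ∀ n, Ω n → E s) : Prop :=
  ∀ ε : ℝ, 0 < ε → Tendsto (fun n => P n {ω | ε ≤ ‖X n ω‖}) atTop (𝓝 0)

/-- The distribution of `Z` is spherical: `H Z` has the law of `Z` for each orthogonal `H`. -/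
def IsSpherical {Ω : Type*} [MeasurableSpace Ω] (P : Measure Ω) (Z : Ω → E s) : Prop :=
  ∀ H ∈ Matrix.orthogonalGroup (Fin s) ℝ, IdentDistrib (fun ω => app H (Z ω)) Z P P

/-- `ζ_m² = Z_1² + ⋯ + Z_m²`. -/
def zetaSq {Ω : Type*} (m : ℕ) (Z : Ω → E s) (ω : Ω) : ℝ :=
  ∑ i : Fin s, if i.val < m then Z ω i ^ 2 else 0

end MeanLocation

end

open MeanLocation

/-! ### Convergence in distribution on varying probability spaces. -/

section ConvergenceInDistribution

variable {F : Type*} [NormedAddCommGroup F] [MeasurableSpace F]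
  [BorelSpace F] {Ω : ℕ → Type*} [∀ n, MeasurableSpace (Ω n)] {P : ∀ n, Measure (Ω n)}
  [∀ n, IsProbabilityMeasure (P n)]
  {Ω' Ω'' : Type*} [MeasurableSpace Ω'] {P' : Measure Ω'} [IsProbabilityMeasure P']
  [MeasurableSpace Ω''] {P'' : Measure Ω''} [IsProbabilityMeasure P'']

/-! The theorem is a delta method for the nearest-point mapping `π`, followed by a computation with
spherical laws.

Differentiability (`nearestPoint_differentiable`): in a chart flattening `M` to a linear space `L`,
nearest points are zeros of the gradient of the square distance along `L`. Off the cutlocus the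
Hessian at the unique nearest point is invertible, so the implicit function theorem gives a smooth
local branch of zeros. Compactness forces every nearest point of every `x` near `t` onto this
branch. Hence a neighbourhood of `t` avoids the cutlocus, and `π` is differentiable at `t`. Write `T
= tan_μ`. Differentiating `tan_{π x} (x - π x) = 0` at `t` gives `G D = T` for the derivative `D` of
`π`: the derivative of the projection field, applied to the normal vector `t - μ`, is the Weingarten
term. Only this identity is used, so `G` is never inverted.

Linearization: convergence in distribution makes `Z_n` asymptotically tight, and on `‖Z_n‖ < K` the
distance from `t_n` to `t` is of order `1 / a_n`. Continuity of `π` at `t` then gives consistency.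
With `S = nor_μ + T V T`, the first-order expansion gives `a_n S^{-1/2} G (μ_n - μ) = K' Z_n +
o_P(1)`, where `K' = S^{-1/2} T V^{1/2}`.

Limit law: `T` commutes with `S`, so `K' K'ᵀ = T` and `T K' = K'` (`invRootMat_compress_mul_star`,
`compress_invRootMat`). Thus `K'` is `T` followed after an orthogonal map, `K' = T U⁻¹`, and
sphericity gives `K' Z` the law of `T Z`. Sphericity also lets the tangent space be rotated onto the
first `m` coordinates, which identifies the limit of the quadratic form. -/

/-- Convergence in distribution only depends on the laws of the sequence and of the limit. -/
theorem tendstoInDistribution_of_map_eq {Υ : ℕ → Type*} [∀ n, MeasurableSpace (Υ n)]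
    {Q : ∀ n, Measure (Υ n)} [∀ n, IsProbabilityMeasure (Q n)]
    {X : ∀ n, Ω n → F} {Y : ∀ n, Υ n → F} {Z : Ω' → F} {W : Ω'' → F}
    (h : TendstoInDistribution X atTop Z P P')
    (hY : ∀ n, AEMeasurable (Y n) (Q n)) (hXY : ∀ n, (P n).map (X n) = (Q n).map (Y n))
    (hZW : IdentDistrib Z W P' P'') : TendstoInDistribution Y atTop W Q P'' where
  forall_aemeasurable := hY
  aemeasurable_limit := hZW.aemeasurable_snd
  tendsto := by
    have e1 : (fun n => (⟨(P n).map (X n),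
        Measure.isProbabilityMeasure_map (h.forall_aemeasurable n)⟩ : ProbabilityMeasure F)) =
        fun n => ⟨(Q n).map (Y n), Measure.isProbabilityMeasure_map (hY n)⟩ :=
      funext fun n => Subtype.ext (hXY n)
    have e2 : (⟨P'.map Z, Measure.isProbabilityMeasure_map h.aemeasurable_limit⟩ :
        ProbabilityMeasure F) =
        ⟨P''.map W, Measure.isProbabilityMeasure_map hZW.aemeasurable_snd⟩ :=
      Subtype.ext hZW.map_eq
    have := h.tendsto
    rw [e1, e2] at this
    exact this

theorem MeasureTheory.TendstoInDistribution.of_identDistrib {X : ∀ n, Ω n → F} {Z : Ω' → F}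
    {W : Ω'' → F} (h : TendstoInDistribution X atTop Z P P') (hZW : IdentDistrib Z W P' P'') :
    TendstoInDistribution X atTop W P P'' :=
  tendstoInDistribution_of_map_eq h h.forall_aemeasurable (fun _ => rfl) hZW

/-- Slutsky's lemma for sequences of random variables on varying probability spaces. -/
theorem MeasureTheory.TendstoInDistribution.of_norm_sub_tendsto_zero
    [SecondCountableTopology F] {X Y : ∀ n, Ω n → F} {Z : Ω' → F}
    (h : TendstoInDistribution X atTop Z P P') (hY : ∀ n, AEMeasurable (Y n) (P n))
    (hXY : ∀ ε : ℝ, 0 < ε → Tendsto (fun n => P n {ω | ε ≤ ‖Y n ω - X n ω‖}) atTop (𝓝 0)) :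
    TendstoInDistribution Y atTop Z P P' := by
  have hX := h.forall_aemeasurable
  have hp : ∀ n, AEMeasurable (fun ω => (X n ω, Y n ω)) (P n) := fun n => (hX n).prodMk (hY n)
  have : ∀ n, IsProbabilityMeasure ((P n).map fun ω => (X n ω, Y n ω)) :=
    fun n => Measure.isProbabilityMeasure_map (hp n)
  -- All pairs are moved to one probability space, the product of their joint laws. The dependence
  -- between different `n` is irrelevant, since both the hypothesis and the conclusion involve only
  -- the law of each pair separately. Slutsky's lemma on a single space then applies.
  set Q : Measure (ℕ → F × F) := Measure.infinitePi fun n => (P n).map fun ω => (X n ω, Y n ω)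
    with hQ
  have hm : ∀ n, Q.map (fun w => w n) = (P n).map fun ω => (X n ω, Y n ω) := fun n =>
    Measure.infinitePi_map_eval _ n
  have key : ∀ n {G : Type _} [MeasurableSpace G] (g : F × F → G), Measurable g →
      Q.map (fun w => g (w n)) = (P n).map fun ω => g (X n ω, Y n ω) := by
    intro n G _ g hg
    have := congrArg (Measure.map g) (hm n)
    rw [AEMeasurable.map_map_of_aemeasurable hg.aemeasurable (hp n),
      Measure.map_map hg (measurable_pi_apply n)] at this
    exact this
  have h1 : TendstoInDistribution (fun n (w : ℕ → F × F) => (w n).1) atTop Z (fun _ => Q) P' :=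
    tendstoInDistribution_of_map_eq h (fun n => (measurable_fst.comp (measurable_pi_apply n)).aemeasurable)
      (fun n => (key n Prod.fst measurable_fst).symm) (IdentDistrib.refl h.aemeasurable_limit)
  have h2 : TendstoInDistribution (fun n (w : ℕ → F × F) => (w n).2) atTop Z (fun _ => Q) P' := by
    refine tendstoInDistribution_of_tendstoInMeasure_sub _ _ h1 ?_
      (fun n => (measurable_snd.comp (measurable_pi_apply n)).aemeasurable)
    rw [tendstoInMeasure_iff_norm]
    intro ε hε
    refine (hXY ε hε).congr fun n => ?_
    have hs : MeasurableSet {p : F × F | ε ≤ ‖p.2 - p.1‖} :=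
      measurableSet_le measurable_const (by fun_prop)
    have hQs : Q.map (fun w => w n) {p : F × F | ε ≤ ‖p.2 - p.1‖} =
        Q {w | ε ≤ ‖(w n).2 - (w n).1‖} := Measure.map_apply (measurable_pi_apply n) hs
    have hPs : ((P n).map fun ω => (X n ω, Y n ω)) {p : F × F | ε ≤ ‖p.2 - p.1‖} =
        P n {ω | ε ≤ ‖Y n ω - X n ω‖} := Measure.map_apply_of_aemeasurable (hp n) hs
    rw [hm n, hPs] at hQs
    simpa using hQs
  exact tendstoInDistribution_of_map_eq h2 hY (fun n => key n Prod.snd measurable_snd)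
    (IdentDistrib.refl h.aemeasurable_limit)

/-- A sequence which converges in distribution is asymptotically tight. -/
theorem MeasureTheory.TendstoInDistribution.exists_eventually_measure_norm_ge_le
    {X : ∀ n, Ω n → F} {Z : Ω' → F} (h : TendstoInDistribution X atTop Z P P')
    {ε : ENNReal} (hε : 0 < ε) :
    ∃ K : ℝ, ∀ᶠ n in atTop, P n {ω | K ≤ ‖X n ω‖} ≤ ε := by
  have hZ := h.aemeasurable_limit
  have hcl : ∀ K : ℝ, IsClosed {x : F | K ≤ ‖x‖} := fun K =>
    isClosed_le continuous_const continuous_norm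
  have := Measure.isProbabilityMeasure_map hZ
  -- The limit law is tight: the closed sets `{k ≤ ‖x‖}` decrease to the empty set. Closedness then
  -- carries the bound to the laws of `X n` by the portmanteau theorem.
  have hlim : Tendsto (fun k : ℕ => P'.map Z {x : F | (k : ℝ) ≤ ‖x‖}) atTop (𝓝 0) := by
    have : ⋂ k : ℕ, {x : F | (k : ℝ) ≤ ‖x‖} = ∅ := by
      ext x
      simp only [Set.mem_iInter, Set.mem_ofPred_eq, Set.mem_empty_iff_false, iff_false, not_forall,
        not_le]
      exact exists_nat_gt ‖x‖
    rw [← measure_empty (μ := P'.map Z), ← this]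
    refine tendsto_measure_iInter_atTop (fun k => (hcl k).measurableSet.nullMeasurableSet) ?_
      ⟨0, measure_ne_top _ _⟩
    intro i j hij x hx
    simp only [Set.mem_ofPred_eq] at hx ⊢
    exact le_trans (Nat.cast_le.2 hij) hx
  obtain ⟨k, hk⟩ := (hlim.eventually_lt_const hε).exists
  refine ⟨k, ?_⟩
  have h1 := ProbabilityMeasure.limsup_measure_closed_le_of_tendsto h.tendsto (hcl k)
  filter_upwards [eventually_lt_of_limsup_lt (h1.trans_lt hk)] with n hn
  have := hn.le
  simp only [ProbabilityMeasure.coe_mk] at this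
  rwa [Measure.map_apply_of_aemeasurable (h.forall_aemeasurable n) (hcl k).measurableSet] at this

end ConvergenceInDistribution

namespace MeanLocation

variable {s : ℕ} {Ω : ℕ → Type*} [∀ n, MeasurableSpace (Ω n)] {P : ∀ n, Measure (Ω n)}
  [∀ n, IsProbabilityMeasure (P n)]
  {Ω' : Type*} [MeasurableSpace Ω'] {P' : Measure Ω'} [IsProbabilityMeasure P']

/-- If `Y n` is eventually small as long as `X n` stays bounded, where `X n` converges in
distribution, then `Y n` converges to zero in probability. -/
theorem tendstoZeroInProb_of_bounded {X Y : ∀ n, Ω n → E s} {Z : Ω' → E s}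
    (h : TendstoInDistribution X atTop Z P P')
    (hY : ∀ ε : ℝ, 0 < ε → ∀ K : ℝ, ∀ᶠ n in atTop, ∀ᵐ ω ∂(P n), ‖X n ω‖ < K → ‖Y n ω‖ < ε) :
    TendstoZeroInProb P Y := by
  intro ε hε
  rw [ENNReal.tendsto_nhds_zero]
  intro η hη
  obtain ⟨K, hK⟩ := h.exists_eventually_measure_norm_ge_le hη
  filter_upwards [hK, hY ε hε K] with n h1 h2
  refine (measure_mono_ae ?_).trans h1
  filter_upwards [h2] with ω hω hle
  by_contra hlt
  exact absurd (hω (not_le.1 hlt)) (not_lt.2 hle)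

end MeanLocation

namespace MeanLocation

variable {s : ℕ}

/-! ### Matrices acting on Euclidean space, and square roots. -/

section Matrices

theorem app_mul (A B : Mat s) (x : E s) : app (A * B) x = app A (app B x) := by
  simp [app]

theorem app_one (x : E s) : app (1 : Mat s) x = x := by simp [app]

theorem app_sub_mat (A B : Mat s) (x : E s) : app (A - B) x = app A x - app B x := by simp [app]

theorem app_sub (A : Mat s) (x y : E s) : app A (x - y) = app A x - app A y := by simp [app]

theorem app_smul (A : Mat s) (c : ℝ) (x : E s) : app A (c • x) = c • app A x := by simp [app]

theorem app_mat (T : E s →L[ℝ] E s) (x : E s) : app (mat T) x = T x := by simp [app, mat]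

theorem continuous_app (A : Mat s) : Continuous (app A) :=
  (Matrix.toEuclideanCLM (n := Fin s) (𝕜 := ℝ) A).continuous

theorem mat_mul (S T : E s →L[ℝ] E s) : mat (S * T) = mat S * mat T := by simp [mat]

theorem mat_one : mat (1 : E s →L[ℝ] E s) = 1 := by simp [mat]

theorem mat_sub (S T : E s →L[ℝ] E s) : mat (S - T) = mat S - mat T := by simp [mat]

theorem star_mat (T : E s →L[ℝ] E s) : star (mat T) = mat (star T) := by
  refine EquivLike.injective (Matrix.toEuclideanCLM (n := Fin s) (𝕜 := ℝ)) ?_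
  rw [map_star, mat, mat, StarAlgEquiv.apply_symm_apply, StarAlgEquiv.apply_symm_apply]

theorem inner_app_left (A : Mat s) (x y : E s) :
    inner ℝ (app A x) y = inner ℝ x (app (star A) y) := by
  have : Matrix.toEuclideanCLM (n := Fin s) (𝕜 := ℝ) (star A) =
    ContinuousLinearMap.adjoint (Matrix.toEuclideanCLM (n := Fin s) (𝕜 := ℝ) A) := by
    rw [map_star]; rfl
  simp only [app, this, ContinuousLinearMap.adjoint_inner_right]

theorem app_injective {A B : Mat s} (h : ∀ x, app A x = app B x) : A = B :=
  (Matrix.toEuclideanCLM (n := Fin s) (𝕜 := ℝ)).injective (ContinuousLinearMap.ext h)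

theorem rootMat_mul_self {B : Mat s} (hB : B.PosDef) : rootMat B * rootMat B = B :=
  CFC.sqrt_mul_sqrt_self B hB.posSemidef.nonneg

theorem isUnit_rootMat {B : Mat s} (hB : B.PosDef) : IsUnit (rootMat B) :=
  (CFC.isUnit_sqrt_iff B hB.posSemidef.nonneg).2 hB.isUnit

theorem star_rootMat (B : Mat s) : star (rootMat B) = rootMat B :=
  (CFC.sqrt_nonneg B).isSelfAdjoint

theorem rootMat_mul_invRootMat {B : Mat s} (hB : B.PosDef) : rootMat B * invRootMat B = 1 :=
  Matrix.mul_nonsing_inv _ ((Matrix.isUnit_iff_isUnit_det _).1 (isUnit_rootMat hB))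

theorem invRootMat_mul_rootMat {B : Mat s} (hB : B.PosDef) : invRootMat B * rootMat B = 1 :=
  Matrix.nonsing_inv_mul _ ((Matrix.isUnit_iff_isUnit_det _).1 (isUnit_rootMat hB))

theorem star_invRootMat (B : Mat s) : star (invRootMat B) = invRootMat B := by
  have h := star_rootMat B
  rw [Matrix.star_eq_conjTranspose] at h ⊢
  rw [invRootMat, Matrix.conjTranspose_nonsing_inv, h]

theorem invRootMat_mul_self {B : Mat s} (hB : B.PosDef) : invRootMat B * invRootMat B = B⁻¹ := by
  rw [invRootMat, ← Matrix.mul_inv_rev, rootMat_mul_self hB]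

/-- A symmetric matrix which commutes with `B` commutes with `B^{-1/2}`. -/
theorem commute_invRootMat {B N : Mat s} (hB : B.PosDef) (h : Commute B N) :
    Commute (invRootMat B) N := by
  -- The square root is a function of `B` in the continuous functional calculus, so it inherits the
  -- commutation.
  have h1 : Commute (rootMat B) N := by
    rw [rootMat, CFC.sqrt_eq_cfc]
    exact Commute.cfc_nnreal h _
  have e1 := rootMat_mul_invRootMat hB
  have e2 := invRootMat_mul_rootMat hB
  calc invRootMat B * N = invRootMat B * (N * rootMat B) * invRootMat B := by
        rw [← mul_assoc, mul_assoc _ (rootMat B), e1, mul_one]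
    _ = N * invRootMat B := by rw [← h1.eq, ← mul_assoc, e2, one_mul]

end Matrices

/-! ### The matrix `nor + tan V tan` and its inverse square root. -/

section StabilizingMatrix

variable {T V : Mat s}

/-- `(1 - T) + T V T` is positive definite for an orthogonal projection `T` and positive definite
`V`. -/
theorem posDef_compl_add_compress (hT : star T = T) (hTT : T * T = T) (hV : V.PosDef) :
    ((1 - T) + T * V * T).PosDef := by
  have hN : (1 - T).PosSemidef := by
    have h : 1 - T = star (1 - T) * (1 - T) := by
      rw [star_sub, star_one, hT, mul_sub, sub_mul, sub_mul, hTT]; simp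
    rw [h]; exact Matrix.posSemidef_conjTranspose_mul_self _
  have hC : (T * V * T).PosSemidef := by
    have := hV.posSemidef.conjTranspose_mul_mul_same T
    rwa [← Matrix.star_eq_conjTranspose, hT] at this
  refine (hN.add hC).posDef_iff_isUnit.2 ?_
  rw [← Matrix.mulVec_injective_iff_isUnit]
  refine (injective_iff_map_eq_zero (Matrix.mulVecLin ((1 - T) + T * V * T))).2 fun x hx => ?_
  rw [Matrix.mulVecLin_apply] at hx
  have h0 := congrArg (star x ⬝ᵥ ·) hx
  simp only [Matrix.add_mulVec, dotProduct_add, dotProduct_zero] at h0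
  have h1 := hN.dotProduct_mulVec_nonneg x
  have h2 := hC.dotProduct_mulVec_nonneg x
  -- For `x` in the kernel, two nonnegative quadratic forms sum to zero. Hence the form of `V`
  -- vanishes at `T x`, so `T x = 0`, and the equation for `x` reduces to `x = 0`.
  have hT0 : T.mulVec x = 0 := by
    have e : star x ⬝ᵥ (T * V * T).mulVec x = 0 := by linarith
    have e' : star x ⬝ᵥ (T * V * T).mulVec x =
        star (T.mulVec x) ⬝ᵥ V.mulVec (T.mulVec x) := by
      rw [Matrix.star_mulVec, ← Matrix.star_eq_conjTranspose, hT, ← Matrix.dotProduct_mulVec,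
        Matrix.mulVec_mulVec, Matrix.mulVec_mulVec, mul_assoc]
    by_contra hne
    exact absurd (e'.symm.trans e) (hV.dotProduct_mulVec_pos hne).ne'
  rw [Matrix.add_mulVec, ← Matrix.mulVec_mulVec, hT0, Matrix.mulVec_zero, add_zero, Matrix.sub_mulVec, hT0,
    Matrix.one_mulVec, sub_zero] at hx
  exact hx

/-- With `S = (1 - T) + T V T` and `K = S^{-1/2} T V^{1/2}` one has `K Kᵀ = T`. -/
theorem invRootMat_compress_mul_star (hT : star T = T) (hTT : T * T = T) (hV : V.PosDef) :
    (invRootMat ((1 - T) + T * V * T) * T * rootMat V) *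
      star (invRootMat ((1 - T) + T * V * T) * T * rootMat V) = T := by
  have hS := posDef_compl_add_compress hT hTT hV
  set S := (1 - T) + T * V * T with hSdef
  have hTS : S * T = T * V * T := by
    rw [hSdef, add_mul, sub_mul, hTT, one_mul, sub_self, zero_add, mul_assoc, hTT]
  have hST : T * S = T * V * T := by
    rw [hSdef, mul_add, mul_sub, hTT, mul_one, sub_self, zero_add, ← mul_assoc, ← mul_assoc, hTT]
  have hc := commute_invRootMat hS (show Commute S T from hTS.trans hST.symm)
  set W := invRootMat S with hW
  have hWS : W * W * S = 1 := by
    rw [invRootMat_mul_self hS,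
      Matrix.nonsing_inv_mul _ ((Matrix.isUnit_iff_isUnit_det _).1 hS.isUnit)]
  calc W * T * rootMat V * star (W * T * rootMat V)
      = W * (T * (rootMat V * rootMat V) * T) * W := by
        rw [star_mul, star_mul, star_rootMat, hT, hW, star_invRootMat]; simp only [mul_assoc]
    _ = W * (S * (T * W)) := by rw [rootMat_mul_self hV, ← hTS]; simp only [mul_assoc]
    _ = W * (S * T) * W := by rw [mul_assoc, mul_assoc]
    _ = T := by
      rw [hTS, ← hST, ← mul_assoc, hc.eq, mul_assoc, mul_assoc]
      have : W * (S * W) = 1 := by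
        have hSW : S * W = W * S := (commute_invRootMat hS (Commute.refl S)).eq.symm
        rw [hSW, ← mul_assoc, hWS]
      rw [this, mul_one]

/-- `T` commutes with `(1 - T) + T V T`, hence with its inverse square root, and is absorbed by the
next factor `T`. -/
theorem compress_invRootMat (hT : star T = T) (hTT : T * T = T) (hV : V.PosDef) :
    T * (invRootMat ((1 - T) + T * V * T) * T * rootMat V) =
      invRootMat ((1 - T) + T * V * T) * T * rootMat V := by
  have hS := posDef_compl_add_compress hT hTT hV
  set S := (1 - T) + T * V * T with hSdef
  have hTS : S * T = T * V * T := by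
    rw [hSdef, add_mul, sub_mul, hTT, one_mul, sub_self, zero_add, mul_assoc, hTT]
  have hST : T * S = T * V * T := by
    rw [hSdef, mul_add, mul_sub, hTT, mul_one, sub_self, zero_add, ← mul_assoc, ← mul_assoc, hTT]
  have hc := commute_invRootMat hS (show Commute S T from hTS.trans hST.symm)
  rw [← mul_assoc, ← mul_assoc, ← hc.eq, mul_assoc _ T T, hTT]

end StabilizingMatrix

/-! ### Spherical distributions under projections. -/

section Spherical

variable {Ω : Type*} [MeasurableSpace Ω] {P : Measure Ω} {Z : Ω → E s}

theorem IsSpherical.identDistrib (h : IsSpherical P Z) (U : E s ≃ₗᵢ[ℝ] E s) :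
    IdentDistrib (fun ω => U (Z ω)) Z P P := by
  have hU : mat (U : E s →L[ℝ] E s) ∈ Matrix.orthogonalGroup (Fin s) ℝ := by
    refine Matrix.mem_unitaryGroup_iff.2 ?_
    rw [star_mat, ← mat_mul, ← mat_one]
    congr 1
    have h2 : star (U : E s →L[ℝ] E s) = (U.symm : E s →L[ℝ] E s) :=
      LinearIsometryEquiv.adjoint_eq_symm U
    rw [h2]
    ext1 x
    simp
  simpa [app_mat] using h _ hU

/-- `K Z` and `T Z` have the same law if `Z` is spherical and `K Kᵀ = T` for an orthogonal
projection `T` with `T K = K`. -/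
theorem IsSpherical.identDistrib_app (h : IsSpherical P Z) {T K : Mat s} (hT : star T = T)
    (hTT : T * T = T) (hKK : K * star K = T) (hTK : T * K = K) :
    IdentDistrib (fun ω => app K (Z ω)) (fun ω => app T (Z ω)) P P := by
  let S : Submodule ℝ (E s) := LinearMap.range (Matrix.toEuclideanCLM (n := Fin s) (𝕜 := ℝ) T).toLinearMap
  have hS : ∀ x : S, app T x = x := by
    rintro ⟨_, y, rfl⟩
    change app T (app T y) = app T y
    rw [← app_mul, hTT]
  -- On the range of `T`, `Kᵀ` is isometric: `‖Kᵀ x‖² = ⟨K Kᵀ x, x⟩ = ⟨T x, x⟩ = ‖x‖²`. It therefore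
  -- extends to an orthogonal map `U` of the whole space.
  let L : S →ₗᵢ[ℝ] E s :=
    { toLinearMap := (Matrix.toEuclideanCLM (n := Fin s) (𝕜 := ℝ) (star K)).toLinearMap ∘ₗ S.subtype
      norm_map' := fun x => by
        change ‖app (star K) x‖ = ‖(x : E s)‖
        rw [← sq_eq_sq₀ (norm_nonneg _) (norm_nonneg _), ← real_inner_self_eq_norm_sq,
          inner_app_left, star_star, ← app_mul, hKK, hS, real_inner_self_eq_norm_sq] }
  let U : E s ≃ₗᵢ[ℝ] E s := L.extend.toLinearIsometryEquiv rfl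
  have hU : ∀ y, U (app T y) = app (star K) (app T y) := fun y =>
    L.extend_apply ⟨app T y, y, rfl⟩
  -- This is the adjoint of `U T = Kᵀ T = (T K)ᵀ = Kᵀ`. Since `U⁻¹ Z` has the law of `Z`, applying
  -- `T` finishes the proof.
  have hK : ∀ x, app T (U.symm x) = app K x := fun x => by
    refine ext_inner_right ℝ fun y => ?_
    rw [inner_app_left, hT, ← U.inner_map_map, U.apply_symm_apply, hU, ← inner_app_left]
    nth_rw 1 [← hT]
    rw [← inner_app_left, ← app_mul, hTK]
  have := (h.identDistrib U.symm).comp (continuous_app T).measurable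
  simpa [Function.comp_def, hK] using this

/-- The squared norm of the orthogonal projection of a spherical random vector onto an
`m`-dimensional subspace has the law of `ζ_m²`. -/
theorem IsSpherical.identDistrib_zetaSq (h : IsSpherical P Z) {m : ℕ} (W : Submodule ℝ (E s))
    (hW : Module.finrank ℝ W = m) :
    IdentDistrib (fun ω => ‖W.starProjection (Z ω)‖ ^ 2) (zetaSq m Z) P P := by
  let b : OrthonormalBasis (Fin m) ℝ W := (stdOrthonormalBasis ℝ W).reindex (finCongr hW)
  have hms : m ≤ s := by
    have := W.finrank_le
    rwa [hW, finrank_euclideanSpace_fin] at this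
  let v : Fin s → E s := fun i => if hi : i.val < m then b ⟨i.val, hi⟩ else 0
  have hv : Orthonormal ℝ (Set.domRestrict {i : Fin s | i.val < m} v) := by
    have e : Set.domRestrict {i : Fin s | i.val < m} v =
        fun i => ((b ⟨i.1.val, i.2⟩ : W) : E s) := by
      ext1 ⟨i, hi⟩
      have hi' : i.val < m := hi
      change (if hi : i.val < m then (b ⟨i.val, hi⟩ : E s) else 0) = _
      rw [dif_pos hi']
    rw [e]
    refine (b.orthonormal.comp_linearIsometry W.subtypeₗᵢ).comp
      (fun i : {i : Fin s | i.val < m} => (⟨i.1.val, i.2⟩ : Fin m)) fun i j hij => ?_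
    exact Subtype.ext (Fin.ext (Fin.mk.inj_iff.1 hij))
  obtain ⟨β, hβ⟩ := hv.exists_orthonormalBasis_extension_of_card_eq
    (by simp : Module.finrank ℝ (E s) = Fintype.card (Fin s))
  have hβ1 : ∀ i : Fin s, ∀ hi : i.val < m, β i = b ⟨i.val, hi⟩ := fun i hi => by
    rw [hβ i hi]; simp [v, hi]
  have hT1 : ∀ i : Fin s, W.starProjection (β i) = if i.val < m then β i else 0 := fun i => by
    split_ifs with hi
    · rw [Submodule.starProjection_eq_self_iff, hβ1 i hi]; exact Submodule.coe_mem _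
    · rw [Submodule.starProjection_apply_eq_zero_iff, Submodule.mem_orthogonal]
      intro u hu
      have hb := b.sum_repr ⟨u, hu⟩
      have hb' : u = ∑ j, b.repr ⟨u, hu⟩ j • (b j : E s) := by
        have := congrArg (W.subtype) hb
        simpa using this.symm
      rw [hb', sum_inner]
      refine Finset.sum_eq_zero fun j _ => ?_
      have hj : (b j : E s) = β ⟨j.val, j.2.trans_le hms⟩ := (hβ1 ⟨j.val, _⟩ j.2).symm
      rw [inner_smul_left, hj, β.inner_eq_zero, mul_zero]
      intro hij
      exact hi (by rw [← hij]; exact j.2)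
  -- The orthogonal map `β.repr.symm` sends the standard basis to `β`, hence the span of the first
  -- `m` coordinate vectors onto `W`.
  have hn : ∀ x : E s, ‖W.starProjection (β.repr.symm x)‖ ^ 2 =
      ∑ i : Fin s, if i.val < m then x i ^ 2 else 0 := fun x => by
    rw [← β.sum_sq_norm_inner_right]
    refine Finset.sum_congr rfl fun i _ => ?_
    rw [← Submodule.inner_starProjection_left_eq_right, hT1]
    split_ifs with hi
    · rw [← β.repr_apply_apply, LinearIsometryEquiv.apply_symm_apply, Real.norm_eq_abs, sq_abs]
    · simp
  have hg : Measurable fun x : E s => ‖W.starProjection x‖ ^ 2 := by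
    have : Continuous fun x : E s => ‖W.starProjection x‖ ^ 2 := by fun_prop
    exact this.measurable
  have := ((h.identDistrib β.repr.symm).comp hg).symm
  simp only [Function.comp_def, hn] at this
  exact this

end Spherical

end MeanLocation

/-! ### The orthogonal projection onto the range of a linear map, as a differentiable function of
the map. -/

section RangeProjection

variable {F H : Type*} [NormedAddCommGroup F] [InnerProductSpace ℝ F] [FiniteDimensional ℝ F]
  [NormedAddCommGroup H] [InnerProductSpace ℝ H] [FiniteDimensional ℝ H]

/-- Taking adjoints, as a continuous linear map over `ℝ`. -/
noncomputable def adjointCLM (F H : Type*) [NormedAddCommGroup F] [InnerProductSpace ℝ F]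
    [FiniteDimensional ℝ F] [NormedAddCommGroup H] [InnerProductSpace ℝ H]
    [FiniteDimensional ℝ H] : (F →L[ℝ] H) →L[ℝ] (H →L[ℝ] F) :=
  LinearMap.toContinuousLinearMap
    { toFun := fun A => ContinuousLinearMap.adjoint A
      map_add' := fun A B => map_add _ A B
      map_smul' := fun c A => by simp }

theorem adjointCLM_apply (A : F →L[ℝ] H) :
    adjointCLM F H A = ContinuousLinearMap.adjoint A := rfl

theorem contDiff_adjointCLM {n : WithTop ℕ∞} : ContDiff ℝ n (adjointCLM F H) :=
  (adjointCLM F H).contDiff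

/-- `A (AᵀA)⁻¹ Aᵀ`, the orthogonal projection onto the range of an injective `A`. -/
noncomputable def rangeProj (A : F →L[ℝ] H) : H →L[ℝ] H :=
  A ∘L (adjointCLM F H A ∘L A).inverse ∘L adjointCLM F H A

theorem isInvertible_adjointCLM_comp {A : F →L[ℝ] H} (hA : Function.Injective A) :
    (adjointCLM F H A ∘L A).IsInvertible := by
  have hinj : Function.Injective (adjointCLM F H A ∘L A) := by
    refine (injective_iff_map_eq_zero _).2 fun x hx => hA ?_
    have : inner ℝ (A x) (A x) = (0 : ℝ) := by
      rw [← ContinuousLinearMap.adjoint_inner_right, ← adjointCLM_apply]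
      rw [ContinuousLinearMap.comp_apply] at hx
      rw [hx, inner_zero_right]
    rw [map_zero, inner_self_eq_zero.1 this]
  exact ⟨(LinearEquiv.ofInjectiveEndo (adjointCLM F H A ∘L A).toLinearMap
    hinj).toContinuousLinearEquiv, ContinuousLinearMap.ext fun x => rfl⟩

/-- The normal equations: `Aᵀ (x - A (AᵀA)⁻¹ Aᵀ x) = 0`, so the residual is orthogonal to the range.
-/
theorem rangeProj_eq_starProjection {A : F →L[ℝ] H} (hA : Function.Injective A) :
    rangeProj A = (LinearMap.range A.toLinearMap).starProjection := by
  ext1 x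
  refine (Submodule.eq_starProjection_of_mem_of_inner_eq_zero
    (LinearMap.mem_range_self A.toLinearMap _) ?_).symm
  rintro _ ⟨y, rfl⟩
  change inner ℝ (x - A _) (A y) = _
  have hinv := (isInvertible_adjointCLM_comp hA).self_comp_inverse
  have h2 := ContinuousLinearMap.ext_iff.1 hinv (adjointCLM F H A x)
  rw [← ContinuousLinearMap.adjoint_inner_left, map_sub, ← adjointCLM_apply]
  simp only [ContinuousLinearMap.comp_apply, ContinuousLinearMap.id_apply] at h2
  simp only [ContinuousLinearMap.coe_coe, ContinuousLinearMap.comp_apply] at h2 ⊢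
  rw [h2, sub_self, inner_zero_left]

/-- The explicit formula involves only products, adjoints and one inversion, which is smooth at
invertible operators. This is what makes the tangential projection differentiable along `M`. -/
theorem differentiableAt_rangeProj {A : F →L[ℝ] H} (hA : Function.Injective A) :
    DifferentiableAt ℝ (rangeProj (F := F) (H := H)) A := by
  obtain ⟨e, he⟩ := isInvertible_adjointCLM_comp hA
  have h1 : DifferentiableAt ℝ (ContinuousLinearMap.inverse (R := ℝ) (M := F) (M₂ := F))
      (adjointCLM F H A ∘L A) := by
    rw [← he]
    exact (contDiffAt_map_inverse (n := 1) e).differentiableAt one_ne_zero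
  have h0 : DifferentiableAt ℝ (fun B : F →L[ℝ] H => adjointCLM F H B) A :=
    (adjointCLM F H).differentiableAt
  have h2 : DifferentiableAt ℝ (fun B : F →L[ℝ] H => adjointCLM F H B ∘L B) A :=
    h0.clm_comp differentiableAt_id
  have h3 : DifferentiableAt ℝ (fun B : F →L[ℝ] H => (adjointCLM F H B ∘L B).inverse) A :=
    DifferentiableAt.comp (g := ContinuousLinearMap.inverse)
      (f := fun B : F →L[ℝ] H => adjointCLM F H B ∘L B) A h1 h2
  exact differentiableAt_id.clm_comp (h3.clm_comp h0)

end RangeProjection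

namespace MeanLocation

open scoped ContDiff

variable {s : ℕ} {M : Set (E s)} {Φ : OpenPartialHomeomorph (E s) (E s)}
  {L : Submodule ℝ (E s)}

/-! ### Slice charts: tangent spaces, the projection field and the Weingarten mapping. -/

section SliceChart

theorem IsSliceChart.contDiffAt (h : IsSliceChart M Φ L) {p : E s} (hp : p ∈ Φ.source) :
    ContDiffAt ℝ ∞ Φ p :=
  h.contDiffOn.contDiffAt (Φ.open_source.mem_nhds hp)

theorem IsSliceChart.contDiffAt_symm (h : IsSliceChart M Φ L) {y : E s} (hy : y ∈ Φ.target) :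
    ContDiffAt ℝ ∞ Φ.symm y :=
  h.contDiffOn_symm.contDiffAt (Φ.open_target.mem_nhds hy)

theorem IsSliceChart.hasFDerivAt_symm (h : IsSliceChart M Φ L) {y : E s} (hy : y ∈ Φ.target) :
    HasFDerivAt Φ.symm (fderiv ℝ Φ.symm y) y :=
  ((h.contDiffAt_symm hy).differentiableAt (by simp)).hasFDerivAt

theorem IsSliceChart.contDiffAt_fderiv_symm (h : IsSliceChart M Φ L) {y : E s}
    (hy : y ∈ Φ.target) : ContDiffAt ℝ ∞ (fderiv ℝ Φ.symm) y :=
  (h.contDiffAt_symm hy).fderiv_right (by simp)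

theorem IsSliceChart.fderiv_fderiv_symm (h : IsSliceChart M Φ L) {y : E s} (hy : y ∈ Φ.target)
    (v : E s) : fderiv ℝ Φ (Φ.symm y) (fderiv ℝ Φ.symm y v) = v := by
  have h1 : HasFDerivAt Φ (fderiv ℝ Φ (Φ.symm y)) (Φ.symm y) :=
    ((h.contDiffAt (Φ.map_target hy)).differentiableAt (by simp)).hasFDerivAt
  have h2 := h1.comp y (h.hasFDerivAt_symm hy)
  have h3 : Φ ∘ Φ.symm =ᶠ[𝓝 y] id := Φ.eventually_right_inverse hy
  have h4 := (h2.congr_of_eventuallyEq h3.symm).unique (hasFDerivAt_id y)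
  exact ContinuousLinearMap.ext_iff.1 h4 v

/-- The derivative of the parametrization `Φ.symm` of `M` along `L`. -/
noncomputable def paramDeriv (Φ : OpenPartialHomeomorph (E s) (E s)) (L : Submodule ℝ (E s)) (y : L) :
    L →L[ℝ] E s :=
  fderiv ℝ Φ.symm y ∘L L.subtypeL

theorem paramDeriv_apply (y l : L) : paramDeriv Φ L y l = fderiv ℝ Φ.symm y l := rfl

theorem IsSliceChart.paramDeriv_injective (h : IsSliceChart M Φ L) {y : L}
    (hy : (y : E s) ∈ Φ.target) : Function.Injective (paramDeriv Φ L y) := by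
  intro a b hab
  rw [paramDeriv_apply, paramDeriv_apply] at hab
  have := congrArg (fderiv ℝ Φ (Φ.symm y)) hab
  rw [h.fderiv_fderiv_symm hy, h.fderiv_fderiv_symm hy] at this
  exact Subtype.ext this

theorem IsSliceChart.hasFDerivAt_param (h : IsSliceChart M Φ L) {y : L}
    (hy : (y : E s) ∈ Φ.target) :
    HasFDerivAt (fun z : L => Φ.symm z) (paramDeriv Φ L y) y :=
  (h.hasFDerivAt_symm hy).comp y L.subtypeL.hasFDerivAt

theorem IsSliceChart.contDiffAt_param (h : IsSliceChart M Φ L) {y : L}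
    (hy : (y : E s) ∈ Φ.target) : ContDiffAt ℝ ∞ (fun z : L => Φ.symm z) y :=
  (h.contDiffAt_symm hy).comp y L.subtypeL.contDiff.contDiffAt

theorem IsSliceChart.contDiffAt_paramDeriv (h : IsSliceChart M Φ L) {y : L}
    (hy : (y : E s) ∈ Φ.target) : ContDiffAt ℝ ∞ (paramDeriv Φ L) y :=
  ((h.contDiffAt_fderiv_symm hy).comp y L.subtypeL.contDiff.contDiffAt).clm_comp
    contDiffAt_const

theorem IsSliceChart.symm_mem (h : IsSliceChart M Φ L) {y : L} (hy : (y : E s) ∈ Φ.target) :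
    Φ.symm y ∈ M := by
  rw [h.mem_iff _ (Φ.map_target hy), Φ.right_inv hy]
  exact y.2

theorem eventually_mem_target {y : L} (hy : (y : E s) ∈ Φ.target) :
    ∀ᶠ z : L in 𝓝 y, (z : E s) ∈ Φ.target :=
  continuous_subtype_val.continuousAt.eventually (Φ.open_target.mem_nhds hy)

theorem hasDerivAt_line (y l : L) : HasDerivAt (fun u : ℝ => y + u • l) l 0 := by
  simpa using ((hasDerivAt_id (0 : ℝ)).smul_const l).const_add y

theorem IsSliceChart.hasDerivAt_curve (h : IsSliceChart M Φ L) {y : L}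
    (hy : (y : E s) ∈ Φ.target) (l : L) :
    HasDerivAt (fun u : ℝ => Φ.symm ((y + u • l : L) : E s)) (paramDeriv Φ L y l) 0 := by
  have h1 : HasFDerivAt (fun z : L => Φ.symm z) (paramDeriv Φ L y) (y + (0 : ℝ) • l) := by
    simpa using h.hasFDerivAt_param hy
  exact HasFDerivAt.comp_hasDerivAt (l := fun z : L => Φ.symm z) (f := fun u : ℝ => y + u • l)
    (0 : ℝ) h1 (hasDerivAt_line y l)

theorem tendsto_line (y l : L) : Tendsto (fun u : ℝ => y + u • l) (𝓝 0) (𝓝 y) := by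
  have := (hasDerivAt_line y l).continuousAt.tendsto
  simpa using this

/-- A curve in `M` is read in the chart as a curve in `L`, so its velocity comes from `L`;
conversely, straight lines in `L` parametrize curves in `M` with every velocity in the range. -/
theorem IsSliceChart.tangentSpaceAt_eq (h : IsSliceChart M Φ L) {y : L}
    (hy : (y : E s) ∈ Φ.target) :
    tangentSpaceAt M (Φ.symm y) = LinearMap.range (paramDeriv Φ L y).toLinearMap := by
  apply le_antisymm
  · rw [tangentSpaceAt, Submodule.span_le]
    rintro v ⟨γ, hγ, hγ0, hγM, rfl⟩
    have hs : γ 0 ∈ Φ.source := by rw [hγ0]; exact Φ.map_target hy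
    have hd : HasDerivAt γ (deriv γ 0) 0 := (hγ.differentiableAt (by simp)).hasDerivAt
    have hsrc : ∀ᶠ u in 𝓝 (0 : ℝ), γ u ∈ Φ.source :=
      hd.continuousAt.eventually (Φ.open_source.mem_nhds hs)
    have h1 : HasDerivAt (Φ ∘ γ) (fderiv ℝ Φ (γ 0) (deriv γ 0)) 0 :=
      ((h.contDiffAt hs).differentiableAt (by simp)).hasFDerivAt.comp_hasDerivAt 0 hd
    -- The component of `Φ ∘ γ` orthogonal to `L` vanishes near `0`, so its derivative does too.
    have hL : fderiv ℝ Φ (γ 0) (deriv γ 0) ∈ L := by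
      let ρ := Lᗮ.starProjection
      have h2 : HasDerivAt (fun u => ρ ((Φ ∘ γ) u)) (ρ (fderiv ℝ Φ (γ 0) (deriv γ 0))) 0 :=
        ρ.hasFDerivAt.comp_hasDerivAt 0 h1
      have h3 : (fun u => ρ ((Φ ∘ γ) u)) =ᶠ[𝓝 0] fun _ => 0 := by
        filter_upwards [hγM, hsrc] with u hu hu'
        rw [Submodule.starProjection_apply_eq_zero_iff, Submodule.orthogonal_orthogonal]
        exact (h.mem_iff _ hu').1 hu
      have h4 := (h2.congr_of_eventuallyEq h3.symm).unique (hasDerivAt_const (0 : ℝ) (0 : E s))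
      rwa [Submodule.starProjection_apply_eq_zero_iff, Submodule.orthogonal_orthogonal] at h4
    have hy' : Φ (γ 0) = y := by rw [hγ0, Φ.right_inv hy]
    have h5 : HasDerivAt (Φ.symm ∘ Φ ∘ γ)
        (fderiv ℝ Φ.symm y (fderiv ℝ Φ (γ 0) (deriv γ 0))) 0 := by
      have := h.hasFDerivAt_symm hy
      rw [← hy'] at this ⊢
      exact this.comp_hasDerivAt 0 h1
    have h6 : Φ.symm ∘ Φ ∘ γ =ᶠ[𝓝 0] γ := by
      filter_upwards [hsrc] with u hu using Φ.left_inv hu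
    have h7 := (h5.congr_of_eventuallyEq h6.symm).unique hd
    exact ⟨⟨_, hL⟩, h7⟩
  · rintro _ ⟨l, rfl⟩
    refine Submodule.subset_span ⟨fun u => Φ.symm ((y + u • l : L) : E s), ?_, by simp, ?_,
      (h.hasDerivAt_curve hy l).deriv⟩
    · have h1 : ContDiffAt ℝ ∞ (fun z : L => Φ.symm z) (y + (0 : ℝ) • l) := by
        simpa using h.contDiffAt_param hy
      have h2 : ContDiffAt ℝ ∞ (fun u : ℝ => y + u • l) 0 := by fun_prop
      exact ContDiffAt.comp (g := fun z : L => Φ.symm z) (f := fun u : ℝ => y + u • l) (0 : ℝ) h1 h2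
    · filter_upwards [(tendsto_line y l).eventually (eventually_mem_target hy)] with u hu
      exact h.symm_mem hu

theorem IsSliceChart.finrank_tangentSpaceAt (h : IsSliceChart M Φ L) {p : E s}
    (hp : p ∈ Φ.source) (hpM : p ∈ M) :
    Module.finrank ℝ (tangentSpaceAt M p) = Module.finrank ℝ L := by
  let y : L := ⟨Φ p, (h.mem_iff p hp).1 hpM⟩
  have hy : (y : E s) ∈ Φ.target := Φ.map_source hp
  have e : Φ.symm y = p := Φ.left_inv hp
  rw [← e, h.tangentSpaceAt_eq hy]
  exact LinearMap.finrank_range_of_inj (h.paramDeriv_injective hy)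

theorem IsSubmanifold.finrank_tangentSpaceAt {m : ℕ} (hM : IsSubmanifold m M) {p : E s}
    (hp : p ∈ M) : Module.finrank ℝ (tangentSpaceAt M p) = m := by
  obtain ⟨Φ, L, hs, hL, h⟩ := hM p hp
  rw [h.finrank_tangentSpaceAt hs hp, hL]

/-- The tangential projection field in the chart. -/
noncomputable def projField (Φ : OpenPartialHomeomorph (E s) (E s)) (L : Submodule ℝ (E s)) (y : L) :
    E s →L[ℝ] E s :=
  rangeProj (paramDeriv Φ L y)

theorem IsSliceChart.tanProj_eq (h : IsSliceChart M Φ L) {y : L}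
    (hy : (y : E s) ∈ Φ.target) : tanProj M (Φ.symm y) = projField Φ L y := by
  rw [projField, rangeProj_eq_starProjection (h.paramDeriv_injective hy), tanProj]
  congr 1
  exact h.tangentSpaceAt_eq hy

theorem IsSliceChart.hasFDerivAt_projField (h : IsSliceChart M Φ L) {y : L}
    (hy : (y : E s) ∈ Φ.target) :
    HasFDerivAt (projField Φ L) (fderiv ℝ (projField Φ L) y) y := by
  have h1 := differentiableAt_rangeProj (h.paramDeriv_injective hy)
  have h2 := (h.contDiffAt_paramDeriv hy).differentiableAt (by simp)
  exact (h1.comp y h2).hasFDerivAt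

theorem tanProj_apply_mem (p x : E s) : tanProj M p x ∈ tangentSpaceAt M p :=
  Submodule.starProjection_apply_mem _ _

theorem tanProj_tanProj (p x : E s) : tanProj M p (tanProj M p x) = tanProj M p x :=
  Submodule.starProjection_eq_self_iff.2 (tanProj_apply_mem p x)

theorem inner_tanProj_left (p x y : E s) :
    inner ℝ (tanProj M p x) y = inner ℝ x (tanProj M p y) :=
  Submodule.inner_starProjection_left_eq_right _ _ _

theorem IsSliceChart.tanProj_paramDeriv (h : IsSliceChart M Φ L) {y : L}
    (hy : (y : E s) ∈ Φ.target) (l : L) :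
    tanProj M (Φ.symm y) (paramDeriv Φ L y l) = paramDeriv Φ L y l := by
  rw [tanProj, Submodule.starProjection_eq_self_iff, h.tangentSpaceAt_eq hy]
  exact ⟨l, rfl⟩

theorem IsSliceChart.exists_paramDeriv_eq_tanProj (h : IsSliceChart M Φ L) {y : L}
    (hy : (y : E s) ∈ Φ.target) (x : E s) :
    ∃ l : L, paramDeriv Φ L y l = tanProj M (Φ.symm y) x := by
  have := tanProj_apply_mem (M := M) (Φ.symm y) x
  rw [h.tangentSpaceAt_eq hy] at this
  exact this

/-- The derivative of the normal field `α ↦ nor_α ν` along `M`. -/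
theorem IsSliceChart.fderivWithin_norProj (h : IsSliceChart M Φ L) {y : L}
    (hy : (y : E s) ∈ Φ.target) (ν : E s) (l : L) :
    fderivWithin ℝ (fun α => norProj M α ν) M (Φ.symm y) (paramDeriv Φ L y l) =
      -(fderiv ℝ (projField Φ L) y l ν) := by
  have hps := Φ.map_target hy
  let ρ : E s →L[ℝ] L := L.orthogonalProjectionOnto
  have hρ : ∀ z : L, ρ z = z := fun z => Submodule.orthogonalProjectionOnto_mem_subspace_eq_self z
  have hfield : ∀ z : L, (z : E s) ∈ Φ.target →
      norProj M (Φ.symm z) ν = ν - projField Φ L z ν := fun z hz => by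
    simp [norProj, h.tanProj_eq hz]
  have hP : HasFDerivAt (fun z : L => ν - projField Φ L z ν)
      (-((fderiv ℝ (projField Φ L) y).flip ν)) y := by
    have h1 := (h.hasFDerivAt_projField hy).clm_apply (hasFDerivAt_const ν y)
    have h2 := h1.const_sub ν
    refine h2.congr_fderiv ?_
    ext v
    simp
  -- Off `M` the field is replaced by its value at the chart point projected to `L`. This extension
  -- is differentiable in the ambient space and agrees with the field on `M`.
  have hdiff : DifferentiableWithinAt ℝ (fun α => norProj M α ν) M (Φ.symm y) := by
    have e0 : ρ (Φ (Φ.symm y)) = y := by rw [Φ.right_inv hy, hρ]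
    have h1 : DifferentiableAt ℝ (fun α => ρ (Φ α)) (Φ.symm y) :=
      ρ.differentiableAt.comp _ ((h.contDiffAt hps).differentiableAt (by simp))
    have h2 : DifferentiableAt ℝ (fun z : L => ν - projField Φ L z ν) (ρ (Φ (Φ.symm y))) := by
      rw [e0]; exact hP.differentiableAt
    have h3 : DifferentiableAt ℝ (fun α => ν - projField Φ L (ρ (Φ α)) ν) (Φ.symm y) :=
      DifferentiableAt.comp (g := fun z : L => ν - projField Φ L z ν) (f := fun α => ρ (Φ α))
        (Φ.symm y) h2 h1
    refine h3.differentiableWithinAt.congr_of_eventuallyEq ?_ ?_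
    · filter_upwards [self_mem_nhdsWithin,
        mem_nhdsWithin_of_mem_nhds (Φ.open_source.mem_nhds hps)] with α hα hαs
      have hL : Φ α ∈ L := (h.mem_iff α hαs).1 hα
      have e1 : ρ (Φ α) = ⟨Φ α, hL⟩ := hρ ⟨Φ α, hL⟩
      have h4 := hfield ⟨Φ α, hL⟩ (Φ.map_source hαs)
      rw [e1, ← h4]
      exact congrArg (fun q => norProj M q ν) (Φ.left_inv hαs).symm
    · rw [e0]; exact hfield y hy
  have hev := (tendsto_line y l).eventually (eventually_mem_target hy)
  have e0 : Φ.symm ((y + (0 : ℝ) • l : L) : E s) = Φ.symm y := by simp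
  -- The derivative along `M` is tested on the curves `u ↦ Φ.symm (y + u • l)`, where derivatives in
  -- `u` are unique. This determines it on tangent vectors, whatever it is in normal directions.
  have h1 := hdiff.hasFDerivWithinAt
  rw [← e0] at h1
  have h2 := HasFDerivWithinAt.comp_hasDerivAt (0 : ℝ) h1 (h.hasDerivAt_curve hy l)
    (by filter_upwards [hev] with u hu using h.symm_mem hu)
  have h3 : HasDerivAt (fun u : ℝ => ν - projField Φ L (y + u • l) ν)
      (-(fderiv ℝ (projField Φ L) y l ν)) 0 := by
    have h4 : HasFDerivAt (fun z : L => ν - projField Φ L z ν)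
      (-((fderiv ℝ (projField Φ L) y).flip ν)) (y + (0 : ℝ) • l) := by simpa using hP
    exact h4.comp_hasDerivAt (0 : ℝ) (hasDerivAt_line y l)
  have h5 := h3.congr_of_eventuallyEq (f₁ := (fun α => norProj M α ν) ∘
    fun u : ℝ => Φ.symm ((y + u • l : L) : E s))
    (by filter_upwards [hev] with u hu using hfield _ hu)
  have := h2.unique h5
  rwa [e0] at this

theorem IsSliceChart.weingarten_paramDeriv (h : IsSliceChart M Φ L) {y : L}
    (hy : (y : E s) ∈ Φ.target) (ν : E s) (l : L) :
    weingarten M (Φ.symm y) ν (paramDeriv Φ L y l) =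
      tanProj M (Φ.symm y) (fderiv ℝ (projField Φ L) y l ν) := by
  simp only [weingarten, neg_apply, ContinuousLinearMap.comp_apply,
    h.tanProj_paramDeriv hy, h.fderivWithin_norProj hy, map_neg, neg_neg]

theorem inner_weingarten_tanProj (p ν x y : E s) :
    inner ℝ (weingarten M p ν x) y =
      inner ℝ (weingarten M p ν (tanProj M p x)) (tanProj M p y) := by
  simp only [weingarten, neg_apply, ContinuousLinearMap.comp_apply,
    tanProj_tanProj, inner_neg_left, ← inner_tanProj_left]

/-- The second fundamental form: for normal `ν`, the derivative of the tangential projection is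
given by the second derivative of the parametrization. -/
theorem IsSliceChart.inner_fderiv_projField (h : IsSliceChart M Φ L) {y : L}
    (hy : (y : E s) ∈ Φ.target) {ν : E s} (hν : tanProj M (Φ.symm y) ν = 0) (l l' : L) :
    inner ℝ (fderiv ℝ (projField Φ L) y l ν) (paramDeriv Φ L y l') =
      inner ℝ ν (fderiv ℝ (fderiv ℝ Φ.symm) y l l') := by
  have hev := eventually_mem_target hy
  have hP := h.hasFDerivAt_projField hy
  -- The derivative of a family of self-adjoint operators is self-adjoint.
  have hsymm : ∀ a b : E s, inner ℝ (fderiv ℝ (projField Φ L) y l a) b =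
      inner ℝ a (fderiv ℝ (projField Φ L) y l b) := fun a b => by
    have h1 := (hP.clm_apply (hasFDerivAt_const a y)).inner ℝ (hasFDerivAt_const b y)
    have h2 := (hasFDerivAt_const a y).inner ℝ (hP.clm_apply (hasFDerivAt_const b y))
    have h3 := h1.congr_of_eventuallyEq (f₁ := fun z => inner ℝ a (projField Φ L z b)) (by
      filter_upwards [hev] with z hz
      rw [← h.tanProj_eq hz, inner_tanProj_left])
    have h4 := ContinuousLinearMap.ext_iff.1 (h3.unique h2) l
    simpa using h4
  have hJ : HasFDerivAt (fun z : L => fderiv ℝ Φ.symm (z : E s) (l' : E s))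
      (((fderiv ℝ (fderiv ℝ Φ.symm) y).flip (l' : E s)) ∘L L.subtypeL) y := by
    have h1 : HasFDerivAt (fderiv ℝ Φ.symm) (fderiv ℝ (fderiv ℝ Φ.symm) y) (y : E s) :=
      ((h.contDiffAt_fderiv_symm hy).differentiableAt (by simp)).hasFDerivAt
    have h2 : HasFDerivAt (fun z : L => fderiv ℝ Φ.symm (z : E s))
        (fderiv ℝ (fderiv ℝ Φ.symm) y ∘L L.subtypeL) y := h1.comp y L.subtypeL.hasFDerivAt
    refine (h2.clm_apply (hasFDerivAt_const (l' : E s) y)).congr_fderiv ?_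
    ext v
    simp
  -- Write `p` for the projection field and `J` for the derivative of the parametrization.
  -- Differentiating `p J l' = J l'` gives `(∂p) J l' + p ∂J l' = ∂J l'`; pairing with the normal
  -- vector `ν` removes the term containing `p`.
  have h1 := hP.clm_apply hJ
  have h2 := h1.congr_of_eventuallyEq
    (f₁ := fun z : L => fderiv ℝ Φ.symm (z : E s) (l' : E s)) (by
      filter_upwards [hev] with z hz
      rw [← h.tanProj_eq hz]
      exact (h.tanProj_paramDeriv hz l').symm)
  have h3 := ContinuousLinearMap.ext_iff.1 (h2.unique hJ) l
  simp only [add_apply, ContinuousLinearMap.comp_apply,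
    ContinuousLinearMap.flip_apply, Submodule.subtypeL_apply, ← h.tanProj_eq hy] at h3
  rw [hsymm, paramDeriv_apply, ← h3, inner_add_right, ← inner_tanProj_left, hν,
    inner_zero_left, zero_add]

/-- On tangent vectors the bilinear form is `ν` paired with the second derivative of the
parametrization, which is symmetric. It is needed for the symmetry of `G`. -/
theorem IsSliceChart.weingarten_symm (h : IsSliceChart M Φ L) {y : L}
    (hy : (y : E s) ∈ Φ.target) {ν : E s} (hν : tanProj M (Φ.symm y) ν = 0) (a b : E s) :
    inner ℝ (weingarten M (Φ.symm y) ν a) b = inner ℝ a (weingarten M (Φ.symm y) ν b) := by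
  obtain ⟨l, hl⟩ := h.exists_paramDeriv_eq_tanProj hy a
  obtain ⟨l', hl'⟩ := h.exists_paramDeriv_eq_tanProj hy b
  have hs : fderiv ℝ (fderiv ℝ Φ.symm) y l l' = fderiv ℝ (fderiv ℝ Φ.symm) y l' l :=
    ((h.contDiffAt_symm hy).isSymmSndFDerivAt (by simpa using ENat.LEInfty.out)).eq _ _
  rw [inner_weingarten_tanProj, real_inner_comm (weingarten M (Φ.symm y) ν b),
    inner_weingarten_tanProj _ _ b a, ← hl, ← hl', h.weingarten_paramDeriv hy,
    h.weingarten_paramDeriv hy, inner_tanProj_left, inner_tanProj_left,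
    h.tanProj_paramDeriv hy, h.tanProj_paramDeriv hy, h.inner_fderiv_projField hy hν,
    h.inner_fderiv_projField hy hν, hs]

end SliceChart

end MeanLocation

namespace MeanLocation

open scoped ContDiff

variable {s : ℕ} {M : Set (E s)} {Φ : OpenPartialHomeomorph (E s) (E s)}
  {L : Submodule ℝ (E s)}

/-! ### Stability of nearest points under compactness. -/

section NearestPoints

theorem exists_isNearest (hMc : IsCompact M) (hne : M.Nonempty) (x : E s) :
    ∃ p, IsNearest M x p := by
  obtain ⟨p, hp, hmin⟩ := hMc.exists_isMinOn hne
    (f := fun q => ‖q - x‖) (by fun_prop)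
  exact ⟨p, hp, fun q hq => hmin hq⟩

theorem isNearest_nearestPoint {x p : E s} (hp : IsNearest M x p) :
    IsNearest M x (nearestPoint M x) :=
  Classical.epsilon_spec ⟨p, hp⟩

/-- Nearest points of points close to `t` are close to the unique nearest point of `t`. -/
theorem eventually_isNearest_mem (hMc : IsCompact M) {t μ : E s} (hμ : IsNearest M t μ)
    (huniq : ∀ p, IsNearest M t p → p = μ) {U : Set (E s)} (hU : U ∈ 𝓝 μ) :
    ∀ᶠ x in 𝓝 t, ∀ p, IsNearest M x p → p ∈ U := by
  obtain ⟨U', hU'U, hU'o, hμU'⟩ := mem_nhds_iff.1 hU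
  rcases (M \ U').eq_empty_or_nonempty with he | hne
  · refine Eventually.of_forall fun x p hp => hU'U ?_
    by_contra hpU
    have : p ∈ M \ U' := ⟨hp.1, hpU⟩
    rw [he] at this
    exact this
  -- Uniqueness gives a strict gap between the distance from `t` to `μ` and that from `t` to the
  -- part of `M` outside `U'`. Moving `t` by less than half the gap cannot make an outside point
  -- nearest.
  · obtain ⟨q, hq, hmin⟩ := (hMc.diff hU'o).exists_isMinOn hne
      (f := fun q => ‖q - t‖) (by fun_prop)
    have hlt : ‖μ - t‖ < ‖q - t‖ := by
      by_contra hle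
      push Not at hle
      have : q = μ := huniq q ⟨hq.1, fun r hr => hle.trans (hμ.2 r hr)⟩
      exact hq.2 (this ▸ hμU')
    have hδ : 0 < (‖q - t‖ - ‖μ - t‖) / 2 := by linarith
    filter_upwards [Metric.ball_mem_nhds t hδ] with x hx p hp
    refine hU'U ?_
    by_contra hpU
    have h1 : ‖q - t‖ ≤ ‖p - t‖ := hmin ⟨hp.1, hpU⟩
    have h2 := hp.2 μ hμ.1
    have h3 : ‖x - t‖ < (‖q - t‖ - ‖μ - t‖) / 2 := by rwa [← dist_eq_norm]
    have h4 : ‖p - t‖ ≤ ‖p - x‖ + ‖x - t‖ := by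
      simpa using norm_add_le (p - x) (x - t)
    have h5 : ‖μ - x‖ ≤ ‖μ - t‖ + ‖x - t‖ := by
      have := norm_sub_le (μ - t) (x - t)
      simpa using this
    linarith

theorem eventually_isNearest_prod (hMc : IsCompact M) {t μ : E s} (hμ : IsNearest M t μ)
    (huniq : ∀ p, IsNearest M t p → p = μ) {Q : E s × E s → Prop}
    (hQ : ∀ᶠ z in 𝓝 (t, μ), Q z) :
    ∀ᶠ x in 𝓝 t, ∀ p, IsNearest M x p → Q (x, p) := by
  obtain ⟨A, hA, U, hU, hAU⟩ := mem_nhds_prod_iff.1 hQ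
  filter_upwards [hA, eventually_isNearest_mem hMc hμ huniq hU] with x hx h p hp
  exact hAU ⟨hx, h p hp⟩

end NearestPoints

/-! ### Gradient and Hessian of the square distance in a chart. -/

section DistanceGradient

/-- Half of the gradient at `y` along `L` of the square distance `y ↦ ‖Φ.symm y - x‖²`, as a
function of `(x, y)`. -/
noncomputable def distGrad (Φ : OpenPartialHomeomorph (E s) (E s)) (L : Submodule ℝ (E s))
    (z : E s × L) : L :=
  adjointCLM L (E s) (paramDeriv Φ L z.2) (Φ.symm z.2 - z.1)

theorem inner_distGrad (z : E s × L) (l : L) :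
    inner ℝ (distGrad Φ L z) l = inner ℝ (Φ.symm z.2 - z.1) (paramDeriv Φ L z.2 l) :=
  ContinuousLinearMap.adjoint_inner_left _ _ _

theorem IsSliceChart.contDiffAt_distGrad (h : IsSliceChart M Φ L) {x : E s} {y : L}
    (hy : (y : E s) ∈ Φ.target) : ContDiffAt ℝ ∞ (distGrad Φ L) (x, y) := by
  have h1 : ContDiffAt ℝ ∞ (fun z : E s × L => Φ.symm z.2) (x, y) :=
    ContDiffAt.comp (g := fun z : L => Φ.symm z) (f := Prod.snd) (x, y)
      (h.contDiffAt_param hy) contDiffAt_snd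
  have h2 : ContDiffAt ℝ ∞ (fun z : E s × L => paramDeriv Φ L z.2) (x, y) :=
    ContDiffAt.comp (g := paramDeriv Φ L) (f := Prod.snd) (x, y)
      (h.contDiffAt_paramDeriv hy) contDiffAt_snd
  have h3 : ContDiffAt ℝ ∞ (fun z : E s × L => adjointCLM L (E s) (paramDeriv Φ L z.2)) (x, y) :=
    ContDiffAt.comp (g := adjointCLM L (E s)) (f := fun z : E s × L => paramDeriv Φ L z.2) (x, y)
      contDiff_adjointCLM.contDiffAt h2
  exact h3.clm_apply (h1.sub contDiffAt_fst)

/-- The gradient vanishes at nearest points. -/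
theorem IsSliceChart.distGrad_eq_zero (h : IsSliceChart M Φ L) {x : E s} {y : L}
    (hy : (y : E s) ∈ Φ.target) (hn : IsNearest M x (Φ.symm y)) : distGrad Φ L (x, y) = 0 := by
  have hmin : IsLocalMin (fun z : L => ‖Φ.symm z - x‖ ^ 2) y := by
    filter_upwards [eventually_mem_target hy] with z hz
    exact pow_le_pow_left₀ (norm_nonneg _) (hn.2 _ (h.symm_mem hz)) 2
  have hd := ((h.hasFDerivAt_param hy).sub_const x).norm_sq
  have h0 := hmin.hasFDerivAt_eq_zero hd
  refine ext_inner_right ℝ fun l => ?_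
  have h1 := ContinuousLinearMap.ext_iff.1 h0 l
  simp only [smul_apply, ContinuousLinearMap.comp_apply, zero_apply] at h1
  rw [inner_distGrad]
  simpa [inner_sub_left] using h1

theorem IsSliceChart.tanProj_sub_eq_zero (h : IsSliceChart M Φ L) {x : E s} {y : L}
    (hy : (y : E s) ∈ Φ.target) (hn : distGrad Φ L (x, y) = 0) :
    tanProj M (Φ.symm y) (x - Φ.symm y) = 0 := by
  rw [tanProj, Submodule.starProjection_apply_eq_zero_iff, h.tangentSpaceAt_eq hy,
    Submodule.mem_orthogonal']
  rintro _ ⟨l, rfl⟩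
  have := inner_distGrad (Φ := Φ) (x, y) l
  rw [hn, inner_zero_left] at this
  change inner ℝ (x - Φ.symm y) (paramDeriv Φ L y l) = 0
  rw [← neg_sub, inner_neg_left, neg_eq_zero]
  exact this.symm

/-- The derivative of the gradient `distGrad` in the direction of `L`. -/
noncomputable def distHess (Φ : OpenPartialHomeomorph (E s) (E s)) (L : Submodule ℝ (E s))
    (z : E s × L) : L →L[ℝ] L :=
  fderiv ℝ (distGrad Φ L) z ∘L .inr ℝ (E s) L

/-- The Hessian of the square distance along `L`. -/
theorem IsSliceChart.fderiv_fderiv_norm_sq (h : IsSliceChart M Φ L) {x : E s} {y : L}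
    (hy : (y : E s) ∈ Φ.target) (v w : L) :
    fderiv ℝ (fderiv ℝ (fun y => ‖Φ.symm y - x‖ ^ 2)) (y : E s) v w =
      2 * inner ℝ (distHess Φ L (x, y) v) w := by
  set f : E s → ℝ := fun y => ‖Φ.symm y - x‖ ^ 2 with hf
  have hfc : ContDiffAt ℝ ∞ f y := ((h.contDiffAt_symm hy).sub contDiffAt_const).norm_sq ℝ
  have hff : HasFDerivAt (fderiv ℝ f) (fderiv ℝ (fderiv ℝ f) y) (y : E s) :=
    ((hfc.fderiv_right (m := ∞) (by simp)).differentiableAt (by simp)).hasFDerivAt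
  have h1 : HasFDerivAt (fun z : L => fderiv ℝ f z (w : E s))
      (((fderiv ℝ (fderiv ℝ f) y).flip (w : E s)) ∘L L.subtypeL) y := by
    have h2 : HasFDerivAt (fun z : L => fderiv ℝ f (z : E s))
        (fderiv ℝ (fderiv ℝ f) y ∘L L.subtypeL) y := hff.comp y L.subtypeL.hasFDerivAt
    refine (h2.clm_apply (hasFDerivAt_const (w : E s) y)).congr_fderiv ?_
    ext v
    simp
  have h3 : HasFDerivAt (distGrad Φ L) (fderiv ℝ (distGrad Φ L) (x, y)) (x, y) :=
    ((h.contDiffAt_distGrad hy).differentiableAt (by simp)).hasFDerivAt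
  have h4 : HasFDerivAt (fun z : L => distGrad Φ L (x, z)) (distHess Φ L (x, y)) y :=
    HasFDerivAt.comp (g := distGrad Φ L) (f := fun z : L => (x, z)) y h3
      (hasFDerivAt_prodMk_right x y)
  have h5 := (h4.inner ℝ (hasFDerivAt_const w y)).const_mul 2
  -- The factor `2` reflects that `distGrad` is half the gradient.
  have h6 : (fun z : L => fderiv ℝ f z (w : E s)) =ᶠ[𝓝 y]
      fun z : L => 2 * inner ℝ (distGrad Φ L (x, z)) w := by
    filter_upwards [eventually_mem_target hy] with z hz
    have hd := ((h.hasFDerivAt_symm hz).sub_const x).norm_sq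
    rw [hf, hd.fderiv, inner_distGrad, paramDeriv_apply]
    simp [inner_sub_left]
  have h7 := ContinuousLinearMap.ext_iff.1 (h1.unique (h5.congr_of_eventuallyEq h6)) v
  simpa using h7

/-- Nondegeneracy of the Hessian of the square distance, in terms of the derivative of the
gradient. -/
theorem IsSliceChart.isInvertible_of_nondegenerate (h : IsSliceChart M Φ L) {x : E s} {y : L}
    (hy : (y : E s) ∈ Φ.target)
    (hnd : ∀ v ∈ L, (∀ w ∈ L,
      fderiv ℝ (fderiv ℝ (fun y => ‖Φ.symm y - x‖ ^ 2)) (y : E s) v w = 0) → v = 0) :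
    (distHess Φ L (x, y)).IsInvertible := by
  have hinj : Function.Injective (distHess Φ L (x, y)) := by
    refine (injective_iff_map_eq_zero _).2 fun v hv => ?_
    refine Subtype.ext (hnd v v.2 fun w hw => ?_)
    have := h.fderiv_fderiv_norm_sq (x := x) hy v ⟨w, hw⟩
    rw [this, hv, inner_zero_left, mul_zero]
  exact ⟨(LinearEquiv.ofInjectiveEndo (distHess Φ L (x, y)).toLinearMap
    hinj).toContinuousLinearEquiv, ContinuousLinearMap.ext fun x => rfl⟩

/-- The way back from invertibility to the definition of the cutlocus, used to show that points near
`t` also avoid it. -/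
theorem IsSliceChart.hasNondegenerateHessian (h : IsSliceChart M Φ L) {x : E s} {y : L}
    (hy : (y : E s) ∈ Φ.target) (hinv : (distHess Φ L (x, y)).IsInvertible) :
    HasNondegenerateHessian M x (Φ.symm y) := by
  refine ⟨Φ, L, Φ.map_target hy, h, fun v hv hw => ?_⟩
  rw [Φ.right_inv hy] at hw
  have h1 : distHess Φ L (x, y) ⟨v, hv⟩ = 0 := by
    refine ext_inner_right ℝ fun w => ?_
    have h2 := h.fderiv_fderiv_norm_sq (x := x) hy ⟨v, hv⟩ w
    rw [hw w w.2] at h2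
    rw [inner_zero_left]
    linarith
  have h2 := hinv.injective (h1.trans (map_zero _).symm)
  exact congrArg Subtype.val h2

/-- Invertible operators form an open set, and the partial derivative depends continuously on the
point. -/
theorem IsSliceChart.eventually_isInvertible (h : IsSliceChart M Φ L) {x : E s} {y : L}
    (hy : (y : E s) ∈ Φ.target) (hinv : (distHess Φ L (x, y)).IsInvertible) :
    ∀ᶠ z in 𝓝 (x, y), (distHess Φ L z).IsInvertible := by
  obtain ⟨e, he⟩ := hinv
  have h1 : ContDiffAt ℝ ∞ (fderiv ℝ (distGrad Φ L)) (x, y) :=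
    (h.contDiffAt_distGrad hy).fderiv_right (by simp)
  have hc : ContinuousAt (distHess Φ L) (x, y) := h1.continuousAt.clm_comp continuousAt_const
  have hn := e.nhds
  rw [he] at hn
  filter_upwards [hc.eventually hn] with z hz
  obtain ⟨e', he'⟩ := hz
  exact ⟨e', he'⟩

end DistanceGradient

/-! ### Differentiability of the nearest-point mapping. -/

/-- Off the cutlocus of a compact submanifold, the nearest-point mapping is defined in a
neighbourhood and differentiable, with derivative `D` satisfying `G D = tan_μ`, where
`G = I - A_{t - μ} tan_μ` is symmetric. -/
theorem nearestPoint_differentiable (hMc : IsCompact M) {t μ : E s} (ht : t ∉ cutlocus M)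
    (hμ : μ = nearestPoint M t) :
    μ ∈ M ∧ (∀ᶠ x in 𝓝 t, x ∉ cutlocus M) ∧
      (∀ a b, inner ℝ (weingarten M μ (t - μ) a) b = inner ℝ a (weingarten M μ (t - μ) b)) ∧
      ∃ D : E s →L[ℝ] E s, HasFDerivAt (nearestPoint M) D t ∧
        ∀ v, D v - weingarten M μ (t - μ) (D v) = tanProj M μ v := by
  have ht' : (∃! p, IsNearest M t p) ∧ HasNondegenerateHessian M t (nearestPoint M t) := by
    by_contra hcon
    exact ht (by rw [not_and_or] at hcon; exact hcon)
  -- The chart used throughout is the one in which the Hessian is known to be nondegenerate.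
  obtain ⟨⟨p, hp, hpu⟩, Φ, L, hsrc, h, hnd⟩ := ht'
  have hpμ : μ = p := by rw [hμ]; exact hpu _ (isNearest_nearestPoint hp)
  rw [← hμ] at hsrc hnd
  subst hpμ
  have hne : M.Nonempty := ⟨μ, hp.1⟩
  obtain ⟨y, hyΦ⟩ : ∃ y : L, (y : E s) = Φ μ := ⟨⟨Φ μ, (h.mem_iff μ hsrc).1 hp.1⟩, rfl⟩
  have hy : (y : E s) ∈ Φ.target := hyΦ ▸ Φ.map_source hsrc
  have hμy : Φ.symm y = μ := by rw [hyΦ, Φ.left_inv hsrc]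
  rw [← hyΦ] at hnd
  have hinv := h.isInvertible_of_nondegenerate hy hnd
  have h0 : distGrad Φ L (t, y) = 0 := h.distGrad_eq_zero hy (hμy.symm ▸ hp)
  have hcd : ContDiffAt ℝ ∞ (distGrad Φ L) (t, y) := h.contDiffAt_distGrad hy
  have hinf : (∞ : WithTop ℕ∞) ≠ 0 := by simp
  -- The branch of critical points through `(t, y)`: it solves `distGrad = 0`, the value there being
  -- `0`.
  set φ : E s → L := hcd.implicitFunction hinf hinv with hφ
  have hφt : φ t = y := hcd.implicitFunction_apply_self hinf hinv
  obtain ⟨φ', hφ'⟩ : ∃ φ' : E s →L[ℝ] L, HasFDerivAt φ φ' t :=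
    ⟨_, (hcd.hasStrictFDerivAt_implicitFunction hinf hinv).hasFDerivAt⟩
  have hev1 := hcd.eventually_apply_eq_iff_implicitFunction hinf hinv
  have hev2 := h.eventually_isInvertible hy hinv
  let ρ : E s →L[ℝ] L := L.orthogonalProjectionOnto
  have hρ : ∀ z : L, ρ z = z := fun z => Submodule.orthogonalProjectionOnto_mem_subspace_eq_self z
  have hcont : Tendsto (fun z : E s × E s => (z.1, ρ (Φ z.2))) (𝓝 (t, μ)) (𝓝 (t, y)) := by
    have h1 : ContinuousAt Φ μ := (h.contDiffAt hsrc).continuousAt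
    have h2 : ContinuousAt (fun z : E s × E s => (z.1, ρ (Φ z.2))) (t, μ) :=
      continuousAt_fst.prodMk (ρ.continuous.continuousAt.comp
        (ContinuousAt.comp (g := Φ) (f := Prod.snd) (x := (t, μ)) h1 continuousAt_snd))
    have h3 : ρ (Φ μ) = y := by rw [← hyΦ, hρ]
    have := h2.tendsto
    rwa [h3] at this
  have hsrc2 : ∀ᶠ z : E s × E s in 𝓝 (t, μ), z.2 ∈ Φ.source :=
    continuousAt_snd.eventually (Φ.open_source.mem_nhds hsrc)
  have hnear := eventually_isNearest_prod hMc hp hpu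
    ((hcont.eventually (hev1.and hev2)).and hsrc2)
  -- near `t`, the nearest points are given by the implicit function
  have hloc : ∀ᶠ x in 𝓝 t, ∀ q, IsNearest M x q → (φ x : E s) ∈ Φ.target ∧ q = Φ.symm (φ x) ∧
      distGrad Φ L (x, φ x) = 0 ∧
      (distHess Φ L (x, φ x)).IsInvertible := by
    filter_upwards [hnear] with x hx q hq
    obtain ⟨⟨hiff, hinvx⟩, hqs⟩ := hx q hq
    have hΦL : Φ q ∈ L := (h.mem_iff q hqs).1 hq.1
    have hz : ((ρ (Φ q) : L) : E s) = Φ q := congrArg Subtype.val (hρ ⟨Φ q, hΦL⟩)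
    have hzt : ((ρ (Φ q) : L) : E s) ∈ Φ.target := by
      rw [hz]; exact Φ.map_source hqs
    have hqz : q = Φ.symm (ρ (Φ q) : L) := by rw [hz, Φ.left_inv hqs]
    have hg : distGrad Φ L (x, ρ (Φ q)) = 0 := h.distGrad_eq_zero hzt (hqz ▸ hq)
    have hφx : φ x = ρ (Φ q) := hiff.1 (hg.trans h0.symm)
    rw [hφx]
    exact ⟨hzt, hqz, hg, hinvx⟩
  have hall : ∀ᶠ x in 𝓝 t, (φ x : E s) ∈ Φ.target ∧ nearestPoint M x = Φ.symm (φ x) ∧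
      distGrad Φ L (x, φ x) = 0 ∧ x ∉ cutlocus M := by
    filter_upwards [hloc] with x hx
    obtain ⟨q, hq⟩ := exists_isNearest hMc hne x
    have hnp := isNearest_nearestPoint hq
    obtain ⟨h1, h2, h3, h4⟩ := hx _ hnp
    refine ⟨h1, h2, h3, ?_⟩
    -- Uniqueness holds because every nearest point of `x` is `Φ.symm (φ x)`; nondegeneracy because
    -- invertibility persists along the branch.
    rintro (hc | hc)
    · exact hc ⟨_, hnp, fun q' hq' => (hx q' hq').2.1.trans h2.symm⟩
    · exact hc (h2 ▸ h.hasNondegenerateHessian h1 h4)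
  have hν : tanProj M (Φ.symm y) (t - μ) = 0 := by
    have := h.tanProj_sub_eq_zero hy h0
    rwa [hμy] at this ⊢
  refine ⟨hp.1, hall.mono fun x hx => hx.2.2.2, ?_, paramDeriv Φ L y ∘L φ', ?_, ?_⟩
  · have := h.weingarten_symm hy hν
    rwa [hμy] at this
  · have h1 : HasFDerivAt (fun x => Φ.symm (φ x)) (paramDeriv Φ L y ∘L φ') t :=
      HasFDerivAt.comp (g := fun z : L => Φ.symm z) (f := φ) t
        (by rw [hφt]; exact h.hasFDerivAt_param hy) hφ'
    exact h1.congr_of_eventuallyEq (hall.mono fun x hx => hx.2.1)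
  · intro v
    have h1 : HasFDerivAt (fun x => Φ.symm (φ x)) (paramDeriv Φ L y ∘L φ') t :=
      HasFDerivAt.comp (g := fun z : L => Φ.symm z) (f := φ) t
        (by rw [hφt]; exact h.hasFDerivAt_param hy) hφ'
    have h2 : HasFDerivAt (fun x => projField Φ L (φ x))
        (fderiv ℝ (projField Φ L) y ∘L φ') t :=
      HasFDerivAt.comp (g := projField Φ L) (f := φ) t
        (by rw [hφt]; exact h.hasFDerivAt_projField hy) hφ'
    -- Product rule for `tan_{π x} (x - π x)`, which vanishes identically near `t` because `x - π x`
    -- is normal.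
    have h3 := h2.clm_apply (u := fun x => x - Φ.symm (φ x)) ((hasFDerivAt_id t).sub h1)
    have h4 : (fun x => projField Φ L (φ x) (x - Φ.symm (φ x))) =ᶠ[𝓝 t] fun _ => 0 := by
      filter_upwards [hall] with x hx
      rw [← h.tanProj_eq hx.1, h.tanProj_sub_eq_zero hx.1 hx.2.2.1]
    have h5 := ContinuousLinearMap.ext_iff.1
      (h3.unique ((hasFDerivAt_const (0 : E s) t).congr_of_eventuallyEq h4)) v
    have hw := h.weingarten_paramDeriv hy (t - μ) (φ' v)
    have hT := h.tanProj_paramDeriv hy (φ' v)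
    simp only [add_apply, ContinuousLinearMap.comp_apply,
      ContinuousLinearMap.flip_apply, sub_apply, zero_apply, hφt, hμy,
      ContinuousLinearMap.id_apply, ← h.tanProj_eq hy, map_sub] at h5
    rw [hμy] at hw hT
    rw [hT] at h5
    -- After projection to the tangent space, the derivative of the projection field becomes the
    -- Weingarten term at `D v`, while `D v` is already tangent.
    have h6 := congrArg (tanProj M μ) h5
    simp only [map_add, map_sub, tanProj_tanProj, hT, map_zero] at h6
    rw [map_sub] at hw
    rw [map_sub] at hw
    rw [ContinuousLinearMap.comp_apply, hw]
    rw [sub_eq_iff_eq_add, ← sub_eq_zero, ← neg_eq_zero, ← h6]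
    abel

end MeanLocation

/-! ### Assembling the limit theorem. -/

namespace MeanLocation

variable {s : ℕ} {M : Set (E s)}

theorem star_tanMat (p : E s) : star (tanMat M p) = tanMat M p := by
  refine app_injective fun x => ext_inner_right ℝ fun y => ?_
  rw [inner_app_left, star_star, tanMat, app_mat, app_mat, inner_tanProj_left]

theorem tanMat_mul_self (p : E s) : tanMat M p * tanMat M p = tanMat M p :=
  app_injective fun x => by rw [app_mul, tanMat, app_mat, app_mat, tanProj_tanProj]

theorem norMat_eq (p : E s) : norMat M p = 1 - tanMat M p := by
  rw [norMat, norProj, mat_sub, tanMat]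
  congr 1
  exact mat_one

theorem app_stabG (t x : E s) :
    app (stabG M t) x = x - weingarten M (nearestPoint M t) (t - nearestPoint M t) x := by
  rw [stabG, app_sub_mat, app_one, app_mat]

theorem star_stabG {t : E s}
    (h : ∀ a b, inner ℝ (weingarten M (nearestPoint M t) (t - nearestPoint M t) a) b =
      inner ℝ a (weingarten M (nearestPoint M t) (t - nearestPoint M t) b)) :
    star (stabG M t) = stabG M t := by
  refine app_injective fun x => ext_inner_right ℝ fun y => ?_
  rw [inner_app_left, star_star, app_stabG, app_stabG, inner_sub_left, inner_sub_right, h]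

/-- A normalized sequence which stays bounded forces the estimators to be close to `t`. -/
theorem eventually_close_of_bounded {Ω : ℕ → Type*} {t : E s} {tn Zn : ∀ n, Ω n → E s}
    {a : ℕ → ℝ} (ha : Tendsto a atTop atTop) {B : Mat s}
    (hB : ∀ n ω, a n • (tn n ω - t) = app B (Zn n ω)) (K : ℝ) :
    ∃ b : ℝ, 0 < b ∧ ∀ δ : ℝ, 0 < δ → ∀ᶠ n in atTop, 0 < a n ∧ ∀ ω, ‖Zn n ω‖ < K →
      a n * ‖tn n ω - t‖ < b ∧ ‖tn n ω - t‖ < δ := by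
  -- In the bound below, `|K|` allows `K` to be negative, and the added `1` makes the bound positive
  -- and the inequality strict.
  set A := Matrix.toEuclideanCLM (n := Fin s) (𝕜 := ℝ) B
  refine ⟨‖A‖ * |K| + 1, by positivity, fun δ hδ => ?_⟩
  filter_upwards [ha.eventually_gt_atTop 0,
    ha.eventually_ge_atTop ((‖A‖ * |K| + 1) / δ)] with n h0 h1
  refine ⟨h0, fun ω hω => ?_⟩
  have h2 : a n * ‖tn n ω - t‖ ≤ ‖A‖ * |K| := by
    have e : a n * ‖tn n ω - t‖ = ‖A (Zn n ω)‖ := by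
      rw [← abs_of_pos h0, ← Real.norm_eq_abs, ← norm_smul, hB]
      rfl
    rw [e]
    exact (A.le_opNorm _).trans
      (mul_le_mul_of_nonneg_left (hω.le.trans (le_abs_self K)) (norm_nonneg _))
  have h3 : a n * ‖tn n ω - t‖ < ‖A‖ * |K| + 1 := by linarith
  refine ⟨h3, lt_of_mul_lt_mul_left (h3.trans_le ?_) h0.le⟩
  rwa [div_le_iff₀ hδ] at h1

end MeanLocation

theorem theorem2p3 {s m : ℕ} (M : Set (E s))
    (hMc : IsCompact M) (hM : IsSubmanifold m M)
    {Ω : ℕ → Type*} [∀ n, MeasurableSpace (Ω n)]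
    (P : ∀ n, Measure (Ω n)) [∀ n, IsProbabilityMeasure (P n)]
    {Ω' : Type*} [MeasurableSpace Ω'] (P' : Measure Ω') [IsProbabilityMeasure P']
    -- the estimators of `t` and their nearest points on `M`
    (t : E s) (ht : t ∉ cutlocus M)
    (tn : ∀ n, Ω n → E s) (htn : ∀ n, AEMeasurable (tn n) (P n))
    (μn : ∀ n, Ω n → E s) (hμn : ∀ n, AEMeasurable (μn n) (P n))
    (hπ : ∀ n, ∀ᵐ ω ∂(P n), tn n ω ∉ cutlocus M →
      μn n ω = nearestPoint M (tn n ω))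
    (μ : E s) (hμ : μ = nearestPoint M t)
    -- the limit theorem for the estimators
    (a : ℕ → ℝ) (ha : Tendsto a atTop atTop)
    (V : Mat s) (hV : V.PosDef)
    (Zn : ∀ n, Ω n → E s)
    (hZn : ∀ n ω, Zn n ω = a n • app (invRootMat V) (tn n ω - t))
    (Z : Ω' → E s)
    (hZ : TendstoInDistribution Zn atTop Z P P') :
    TendstoZeroInProb P (fun n ω => μn n ω - μ) ∧
    (IsSpherical P' Z →
      (TendstoZeroInProb P (fun n ω =>
          a n • app
            (invRootMat (stabV M V μ) * stabG M t)
            (μn n ω - μ) -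
          app
            (invRootMat (stabV M V μ) * tanMat M μ *
              rootMat V) (Zn n ω)) ∧
        TendstoInDistribution (fun n ω =>
          a n • app
            (invRootMat (stabV M V μ) * stabG M t)
            (μn n ω - μ)) atTop
          (fun ω => app (tanMat M μ) (Z ω)) P P') ∧
      TendstoInDistribution (fun n ω =>
          a n ^ 2 * inner ℝ (μn n ω - μ)
            (app
              (stabG M t * (stabV M V μ)⁻¹ * stabG M t)
              (μn n ω - μ))) atTop
        (zetaSq m Z) P P') := by
  subst hμ
  obtain ⟨hμM, hev, hsymm, D, hD, hGD⟩ := nearestPoint_differentiable hMc ht rfl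
  set μ := nearestPoint M t with hμ
  set T := tanMat M μ with hTdef
  have hT : star T = T := star_tanMat μ
  have hTT : T * T = T := tanMat_mul_self μ
  have hSdef : stabV M V μ = (1 - T) + T * V * T := by rw [stabV, norMat_eq]
  have hS : (stabV M V μ).PosDef := hSdef ▸ posDef_compl_add_compress hT hTT hV
  have hroot : ∀ n ω, a n • (tn n ω - t) = app (rootMat V) (Zn n ω) := fun n ω => by
    rw [hZn, app_smul, ← app_mul, rootMat_mul_invRootMat hV, app_one]
  set W := invRootMat (stabV M V μ) with hW
  set G := stabG M t with hGdef
  have hG : star G = G := star_stabG hsymm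
  have hGDv : ∀ v, app G (D v) = app T v := fun v => by
    rw [hGdef, app_stabG, hTdef, tanMat, app_mat]
    exact hGD v
  -- consistency
  have hcons : TendstoZeroInProb P (fun n ω => μn n ω - μ) := by
    refine tendstoZeroInProb_of_bounded hZ fun ε hε K => ?_
    obtain ⟨b, -, hb⟩ := eventually_close_of_bounded ha hroot K
    obtain ⟨δ, hδ, hball⟩ := Metric.eventually_nhds_iff.1
      (hev.and (hD.continuousAt.eventually (Metric.ball_mem_nhds _ hε)))
    filter_upwards [hb δ hδ] with n hn
    filter_upwards [hπ n] with ω hω hK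
    have hx := hball (by rw [dist_eq_norm]; exact (hn.2 ω hK).2)
    rw [hω hx.1, ← dist_eq_norm]
    exact hx.2
  refine ⟨hcons, fun hsph => ?_⟩
  -- linearization
  have hlin : TendstoZeroInProb P (fun n ω =>
      a n • app (W * G) (μn n ω - μ) - app (W * T * rootMat V) (Zn n ω)) := by
    refine tendstoZeroInProb_of_bounded hZ fun ε hε K => ?_
    obtain ⟨b, hb0, hb⟩ := eventually_close_of_bounded ha hroot K
    set A := Matrix.toEuclideanCLM (n := Fin s) (𝕜 := ℝ) (W * G) with hA
    -- Chosen so that the remainder `η ‖t_n - t‖`, after applying `A` and scaling by `a_n`, stays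
    -- below `ε` when `a_n ‖t_n - t‖ < b`. The `+ 1` covers `A = 0`.
    have hη : 0 < ε / ((‖A‖ + 1) * b) := by positivity
    obtain ⟨δ, hδ, hball⟩ := Metric.eventually_nhds_iff.1
      (hev.and (hD.isLittleO.bound hη))
    filter_upwards [hb δ hδ] with n hn
    filter_upwards [hπ n] with ω hω hK
    obtain ⟨hn1, hn2⟩ := hn.2 ω hK
    obtain ⟨hx1, hx2⟩ := hball (by rw [dist_eq_norm]; exact hn2)
    -- Since `G D = T` and `a_n (t_n - t) = V^{1/2} Z_n`, the subtracted term is `a_n W G D (t_n -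
    -- t)`, so only the Taylor remainder of `π` is left.
    have e : a n • app (W * G) (μn n ω - μ) - app (W * T * rootMat V) (Zn n ω) =
        a n • A (nearestPoint M (tn n ω) - nearestPoint M t - D (tn n ω - t)) := by
      change _ = a n • app (W * G) _
      rw [hω hx1, app_mul _ (rootMat V), ← hroot, app_smul, ← smul_sub]
      congr 1
      rw [app_sub _ _ (D _), app_mul W G (D _), hGDv, ← app_mul]
    rw [e, norm_smul, Real.norm_eq_abs, abs_of_pos hn.1]
    calc a n * ‖A (nearestPoint M (tn n ω) - nearestPoint M t - D (tn n ω - t))‖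
        ≤ a n * ((‖A‖ + 1) * (ε / ((‖A‖ + 1) * b) * ‖tn n ω - t‖)) := by
          refine mul_le_mul_of_nonneg_left ((A.le_opNorm _).trans ?_) hn.1.le
          exact mul_le_mul (by linarith) hx2 (norm_nonneg _) (by positivity)
      _ = ε / b * (a n * ‖tn n ω - t‖) := by field_simp
      _ < ε / b * b := by
          exact mul_lt_mul_of_pos_left hn1 (by positivity)
      _ = ε := by field_simp
  have hKK := invRootMat_compress_mul_star hT hTT hV
  have hTK := compress_invRootMat hT hTT hV
  rw [← hSdef, ← hW] at hKK hTK
  have hlim : TendstoInDistribution (fun n ω => a n • app (W * G) (μn n ω - μ)) atTop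
      (fun ω => app T (Z ω)) P P' := by
    have h1 : TendstoInDistribution (fun n ω => app (W * T * rootMat V) (Zn n ω)) atTop
        (fun ω => app (W * T * rootMat V) (Z ω)) P P' :=
      hZ.continuous_comp (continuous_app _)
    have h2 : ∀ n, AEMeasurable (fun ω => a n • app (W * G) (μn n ω - μ)) (P n) := fun n => by
      have hc : Continuous fun x : E s => a n • app (W * G) (x - μ) :=
        ((continuous_app (W * G)).comp (by fun_prop : Continuous fun x : E s => x - μ)).const_smul
          (a n)
      exact hc.measurable.comp_aemeasurable (hμn n)
    exact (h1.of_norm_sub_tendsto_zero h2 hlin).of_identDistrib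
      (hsph.identDistrib_app hT hTT hKK hTK)
  refine ⟨⟨hlin, hlim⟩, ?_⟩
  have hsq : ∀ n ω, a n ^ 2 * inner ℝ (μn n ω - μ)
      (app (G * (stabV M V μ)⁻¹ * G) (μn n ω - μ)) =
        ‖a n • app (W * G) (μn n ω - μ)‖ ^ 2 := fun n ω => by
    -- Symmetry of `G` and `W` turns the quadratic form into a squared norm, so the last claim
    -- follows from the second by continuous mapping.
    have e : G * (stabV M V μ)⁻¹ * G = star (W * G) * (W * G) := by
      rw [star_mul, hG, hW, star_invRootMat, ← invRootMat_mul_self hS]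
      simp only [mul_assoc]
    rw [e, app_mul, ← inner_app_left, real_inner_self_eq_norm_sq, norm_smul, mul_pow,
      Real.norm_eq_abs, sq_abs]
  simp only [hsq]
  have hcont : Continuous fun x : E s => ‖x‖ ^ 2 := by fun_prop
  refine (hlim.continuous_comp hcont).of_identDistrib ?_
  have h3 := hsph.identDistrib_zetaSq (tangentSpaceAt M μ) (hM.finrank_tangentSpaceAt hμM)
  have e : ((fun x : E s => ‖x‖ ^ 2) ∘ fun ω => app T (Z ω)) =
      fun ω => ‖(tangentSpaceAt M μ).starProjection (Z ω)‖ ^ 2 := by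
    funext ω
    simp only [Function.comp_apply, hTdef, tanMat, app_mat]
    rfl
  rw [e]
  exact h3
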